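/- **Setting.** Fix a first-order alphabet (function and predicate symbols with arities) and an infinite set of variables. A *query* is a finite sequence of atoms $A_1,\dots,A_n$; a *clause* $H\gets B$ consists of an atom $H$ and a query $B$; a *program* is a set of clauses. A *moding* assigns to each argument position of each predicate symbol a mode $+$ (input) or $-$ (output); a *3-moding* may also assign $\bot$ (neutral). A sequence of terms is *linear* if no variable occurs in it more than once. **Tidiness.** Let $M'$ be a moding. For a query $Q=A_1,\dots,A_n$ write $A_i\to_Q A_j$ if some variable occurs both in an output position of $A_i$ and in an input position of $A_j$. The query $Q$ is *tidy under* $M'$ if the sequence of the terms in all output positions of $Q$ is linear and $\to_Q$ is acyclic ($A_i\not\to_Q^+A_i$ for all $i$). A clause $H\gets B$ is *tidy under* $M'$ if $B$ is tidy, the sequence of the terms in the input positions of $H$ is linear, and no variable from an input position of $H$ occurs in an output position of $B$. A program $P$ is *weakly tidy under* $M,M'$, where $M$ is a 3-moding and $M'$ a moding, if for each clause $C\in P$ the clause obtained from $C$ by replacing the variables that occur in the $+$ positions (under $M$) of the head of $C$ by ground terms is tidy under $M'$. **SLD-resolution.** A (partial) *selection rule* assigns to each initial fragment of a derivation an occurrence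 of an atom in the last query of the fragment, or selects nothing. An SLD-derivation for $P$ with $Q$ under a selection rule starts with $Q$; if $A$ is selected in the last query $Q',A,Q''$, then the next query is $(Q',B,Q'')\theta$, where $H\gets B$ is a variant of a clause of $P$, standardized apart (variable disjoint from the initial and the last query and from the input clauses and substitutions used earlier), and $\theta$ is any most general unifier of $A$ and $H$. The queries of these derivations are the nodes of the SLD-tree for $P$ with $Q$. The selection rule is *compatible with* $M$ (for $P$ with $Q$) if, in the SLD-tree for $P$ with $Q$, (i) the $+$ positions (under $M$) of each selected atom are ground, and (ii) some atom is selected in each query that contains an atom whose $+$ positions are ground. **Unification without occur-check.** The Martelli–Montanari algorithm repeatedly applies to an arbitrarily chosen equation of the current set one of the following actions, until none is applicable: (1) replace $f(s_1,\dots,s_n)\doteq f(t_1,\dots,t_n)$ by $s_1\doteq t_1,\dots,s_n\doteq t_n$; (2) on $f(\dots)\doteq g(\dots)$ with $f\ne g$, halt with failure; (3) delete $X\doteq X$; (4) replace $t\doteq X$, where $t$ is not a variable, by $X\doteq t$; (5) if $X\doteq t$, $X\notin \mathrm{Var}(t)$ and $X$ occurs elsewhere, apply $\{X/t\}$ to all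 other equations; (6) on $X\doteq t$ with $X\in \mathrm{Var}(t)$, $X\neq t$, halt with failure. ($f,g$ are function symbols or predicate symbols.) A set of equations is *WNSTO* if there is a run (a maximal sequence of actions) on it in which action (6) is not performed. $P$ with $Q$ is *weakly occur-check free* under a selection rule if $\{A\doteq H\}$ is WNSTO whenever $A$ is the selected atom of a query of the SLD-tree for $P$ with $Q$, and $H$ is the head of a standardized apart variant of a clause of $P$ with the same predicate symbol as $A$. **Lemma.** Let $M$ be a 3-moding and $M'$ a moding, let $P$ be a program weakly tidy under $M,M'$, and let $Q$ be a query tidy under $M'$. Then under any selection rule compatible with $M$ (for $P$ with $Q$), 1. each query in any SLD-derivation for $P$ with $Q$ is tidy under $M'$, and 2. $P$ with $Q$ is weakly occur-check free. -/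

import Mathlib

universe u v w

namespace OccurCheck

variable {L : FirstOrder.Language.{u, v}} {V : Type w}

/-! ### Terms, atoms, queries, clauses

The alphabet is a first-order language `L` (function symbols `L.Functions n`, predicate symbols
`L.Relations n`), the variables are the elements of `V`, the terms are those of `L.Term V`. -/

/-- The list of all occurrences of variables in a term, from left to right. -/
def termOccs : L.Term V → List V
  | .var x => [x]
  | .func _ ts => (List.ofFn fun i => termOccs (ts i)).flatten

/-- `Var(t)` for a term `t`. -/
def termVars (t : L.Term V) : Set V := {x | x ∈ termOccs t}

/-- A term is ground when no variable occurs in it. -/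
def IsGround (t : L.Term V) : Prop := termVars t = ∅

/-- A sequence of terms is linear when no variable occurs in it more than once. -/
def LinearSeq (ts : List (L.Term V)) : Prop := (ts.flatMap termOccs).Nodup

variable (L V) in
/-- An atom `p(t₁,…,tₙ)`. -/
structure Atom where
  arity : ℕ
  pred : L.Relations arity
  args : Fin arity → L.Term V

/-- The predicate symbol of an atom (with its arity). -/
def Atom.symbol (A : Atom L V) : Σ n, L.Relations n := ⟨A.arity, A.pred⟩

def Atom.vars (A : Atom L V) : Set V := {x | ∃ i, x ∈ termVars (A.args i)}

variable (L V) in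
/-- A query is a finite sequence of atoms. -/
abbrev Query := List (Atom L V)

def queryVars (Q : Query L V) : Set V := {x | ∃ A ∈ Q, x ∈ A.vars}

variable (L V) in
/-- A definite clause `head ← body`. -/
structure Clause where
  head : Atom L V
  body : Query L V

def Clause.vars (C : Clause L V) : Set V := C.head.vars ∪ queryVars C.body

variable (L V) in
/-- A program is a set of definite clauses. -/
abbrev Program := Set (Clause L V)

/-! ### Substitutions -/

variable (L V) in
/-- A substitution, seen as a map on all variables that moves only finitely many of them. -/
structure Subst where
  map : V → L.Term V
  finite_dom : {x | map x ≠ .var x}.Finite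

/-- `Dom(θ) ∪ Ran(θ)`. -/
def Subst.vars (θ : Subst L V) : Set V :=
  {y | ∃ x, θ.map x ≠ .var x ∧ (y = x ∨ y ∈ termVars (θ.map x))}

/-- Application to an atom of a map from variables to terms. -/
def Atom.subst (A : Atom L V) (f : V → L.Term V) : Atom L V :=
  ⟨A.arity, A.pred, fun i => (A.args i).subst f⟩

def querySubst (Q : Query L V) (f : V → L.Term V) : Query L V := Q.map fun A => A.subst f

def Clause.subst (C : Clause L V) (f : V → L.Term V) : Clause L V :=
  ⟨C.head.subst f, querySubst C.body f⟩

/-- `θ` is a most general unifier of the atoms `A` and `B`: it unifies them, and each unifier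
`τ` of them is of the form `θη` for a substitution `η`. -/
def IsMGU (θ : Subst L V) (A B : Atom L V) : Prop :=
  A.subst θ.map = B.subst θ.map ∧
    ∀ τ : Subst L V, A.subst τ.map = B.subst τ.map →
      ∃ η : Subst L V, ∀ x, (θ.map x).subst η.map = τ.map x

/-- `C'` is obtained from `C` by renaming variables. -/
def IsVariant (C' C : Clause L V) : Prop :=
  ∃ ρ : Equiv.Perm V, C' = C.subst fun x => .var (ρ x)

/-! ### Modings -/

/-- The modes `+` (input) and `-` (output). -/
inductive Mode where
  | input
  | output
  deriving DecidableEq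

/-- The modes `+` (input), `-` (output) and `⊥` (neutral). -/
inductive Mode3 where
  | input
  | output
  | neutral
  deriving DecidableEq

variable (L) in
/-- A moding assigns a mode to each argument position of each predicate. -/
abbrev Moding := ∀ n : ℕ, L.Relations n → Fin n → Mode

variable (L) in
/-- A 3-moding: argument positions may also be neutral. -/
abbrev ThreeModing := ∀ n : ℕ, L.Relations n → Fin n → Mode3

/-- The sequence of the terms in the input positions of an atom. -/
def inTerms (M : Moding L) (A : Atom L V) : List (L.Term V) :=
  ((List.finRange A.arity).filter fun i => M A.arity A.pred i = .input).map A.args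

/-- The sequence of the terms in the output positions of an atom. -/
def outTerms (M : Moding L) (A : Atom L V) : List (L.Term V) :=
  ((List.finRange A.arity).filter fun i => M A.arity A.pred i = .output).map A.args

/-- The sequence of the terms in the input (`+`) positions of an atom, under a 3-moding. -/
def inTerms3 (M : ThreeModing L) (A : Atom L V) : List (L.Term V) :=
  ((List.finRange A.arity).filter fun i => M A.arity A.pred i = .input).map A.args

def varIn (M : Moding L) (A : Atom L V) : Set V := {x | ∃ t ∈ inTerms M A, x ∈ termVars t}

def varOut (M : Moding L) (A : Atom L V) : Set V := {x | ∃ t ∈ outTerms M A, x ∈ termVars t}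

def varIn3 (M : ThreeModing L) (A : Atom L V) : Set V :=
  {x | ∃ t ∈ inTerms3 M A, x ∈ termVars t}

/-- The input positions of `A` (under the 3-moding `M`) are ground. -/
def InputGround (M : ThreeModing L) (A : Atom L V) : Prop := ∀ t ∈ inTerms3 M A, IsGround t

/-! ### Tidy and weakly tidy -/

/-- The relation `→_Q` on the atoms of `Q`: a variable occurs in an output position of `A` and in
an input position of `B`. -/
def arrow (M : Moding L) (Q : Query L V) (A B : Atom L V) : Prop :=
  A ∈ Q ∧ B ∈ Q ∧ ∃ x, x ∈ varOut M A ∧ x ∈ varIn M B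

/-- A query is tidy when it is output linear and `→_Q` is acyclic. -/
def TidyQuery (M : Moding L) (Q : Query L V) : Prop :=
  LinearSeq (Q.flatMap (outTerms M)) ∧ ∀ A ∈ Q, ¬ Relation.TransGen (arrow M Q) A A

/-- A clause is tidy when its body is tidy, its head is input linear, and no variable from an
input position of the head occurs in an output position of the body. -/
def TidyClause (M : Moding L) (C : Clause L V) : Prop :=
  TidyQuery M C.body ∧ LinearSeq (inTerms M C.head) ∧
    ∀ x ∈ varIn M C.head, ∀ B ∈ C.body, x ∉ varOut M B

/-- `θ` grounds the variables that occur in the `+` positions of the head of `C` (under the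
3-moding `M`), and leaves all other variables unchanged. -/
def GroundsHeadInputs (M : ThreeModing L) (C : Clause L V) (θ : Subst L V) : Prop :=
  (∀ x ∈ varIn3 M C.head, IsGround (θ.map x)) ∧ ∀ x ∉ varIn3 M C.head, θ.map x = .var x

/-- `P` is weakly tidy under `M, M'`: the program obtained by grounding, in each clause, the
variables that occur in the `+` positions (under `M`) of its head is tidy under `M'`.
(Which ground terms are used is immaterial, as tidiness depends on variables only.) -/
def WeaklyTidy (M : ThreeModing L) (M' : Moding L) (P : Program L V) : Prop :=
  ∀ C ∈ P, ∃ θ : Subst L V, GroundsHeadInputs M C θ ∧ TidyClause M' (C.subst θ.map)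

/-! ### SLD-resolution -/

variable (L V) in
/-- The data of one resolution step: the position (counted from `0`) of the selected atom in the
query, the input clause, and the mgu. -/
structure SLDStep where
  pos : ℕ
  clause : Clause L V
  mgu : Subst L V

/-- Replace the atom at the given position by the body of the input clause, apply the mgu. -/
def resolvent (Q : Query L V) (s : SLDStep L V) : Query L V :=
  querySubst (Q.take s.pos ++ s.clause.body ++ Q.drop (s.pos + 1)) s.mgu.map

/-- An initial fragment of a derivation is given by its initial query `Q` and the list `h` of the
steps performed so far, the latest step first. This is its last query. -/
def lastQuery (Q : Query L V) : List (SLDStep L V) → Query L V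
  | [] => Q
  | s :: h => resolvent (lastQuery Q h) s

variable (L V) in
/-- A (partial) selection rule: given an initial fragment of a derivation, it selects
(an occurrence of) an atom in the last query, or selects nothing. -/
abbrev SelectionRule :=
  (Q : Query L V) → (h : List (SLDStep L V)) → Option (Fin (lastQuery Q h).length)

/-- The clause `C` is standardized apart with respect to the fragment `(Q, h)`: it is variable
disjoint from the initial query, from the last query, and from the input clauses and the
substitutions of the steps in `h`. -/
def StandardizedApart (Q : Query L V) (h : List (SLDStep L V)) (C : Clause L V) : Prop :=
  Disjoint C.vars (queryVars Q) ∧ Disjoint C.vars (queryVars (lastQuery Q h)) ∧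
    ∀ s ∈ h, Disjoint C.vars s.clause.vars ∧ Disjoint C.vars s.mgu.vars

/-- `C'` may serve as an input clause from `P` after the fragment `(Q, h)`: it is a standardized
apart variant of a clause of `P`. -/
def InputClause (P : Program L V) (Q : Query L V) (h : List (SLDStep L V))
    (C' : Clause L V) : Prop :=
  (∃ C ∈ P, IsVariant C' C) ∧ StandardizedApart Q h C'

/-- `(Q, h)` is an initial fragment of an SLD-derivation for `P` with `Q` via the selection
rule `R`. The queries of the SLD-derivations (finite or infinite) for `P` with `Q`, in other words
the nodes of the SLD-tree, are the last queries of such fragments. -/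
inductive Derivation (P : Program L V) (R : SelectionRule L V) (Q : Query L V) :
    List (SLDStep L V) → Prop
  | nil : Derivation P R Q []
  | cons (h : List (SLDStep L V)) (i : Fin (lastQuery Q h).length) (C : Clause L V)
      (θ : Subst L V) : Derivation P R Q h → R Q h = some i → InputClause P Q h C →
      IsMGU θ ((lastQuery Q h).get i) C.head → Derivation P R Q (⟨i, C, θ⟩ :: h)

/-- The selection rule `R` is compatible with the 3-moding `M` for `P` with `Q`:
the input positions are ground in each selected atom, and some atom is selected in a query
whenever the query contains an atom with its input positions ground. -/
def Compatible (M : ThreeModing L) (P : Program L V) (Q : Query L V)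
    (R : SelectionRule L V) : Prop :=
  ∀ h, Derivation P R Q h →
    (∀ i, R Q h = some i → InputGround M ((lastQuery Q h).get i)) ∧
    ((∃ A ∈ lastQuery Q h, InputGround M A) → ∃ i, R Q h = some i)

/-! ### The Martelli-Montanari algorithm, WNSTO -/

variable (L V) in
/-- Equations between terms, and between atoms. -/
inductive Equation where
  | term (s t : L.Term V)
  | atom (A B : Atom L V)

def Equation.vars : Equation L V → Set V
  | .term s t => termVars s ∪ termVars t
  | .atom A B => A.vars ∪ B.vars

def Equation.subst (f : V → L.Term V) : Equation L V → Equation L V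
  | .term s t => .term (s.subst f) (t.subst f)
  | .atom A B => .atom (A.subst f) (B.subst f)

open Classical in
/-- The map given by the substitution `{X/t}`. -/
noncomputable def single (X : V) (t : L.Term V) : V → L.Term V :=
  Function.update (fun x => .var x) X t

def IsVar (t : L.Term V) : Prop := ∃ x, t = .var x

/-- The actions of the algorithm that do not halt: decomposition (of an equation between terms, or
between atoms), deletion of `X ≐ X`, reorientation, variable elimination. -/
inductive MMAStep : Set (Equation L V) → Set (Equation L V) → Prop
  | decomposeTerm (E : Set (Equation L V)) (n : ℕ) (f : L.Functions n) (s t : Fin n → L.Term V) :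
      .term (.func f s) (.func f t) ∈ E →
      MMAStep E ((E \ {.term (.func f s) (.func f t)}) ∪ Set.range fun i => .term (s i) (t i))
  | decomposeAtom (E : Set (Equation L V)) (n : ℕ) (p : L.Relations n) (s t : Fin n → L.Term V) :
      .atom ⟨n, p, s⟩ ⟨n, p, t⟩ ∈ E →
      MMAStep E ((E \ {.atom ⟨n, p, s⟩ ⟨n, p, t⟩}) ∪ Set.range fun i => .term (s i) (t i))
  | delete (E : Set (Equation L V)) (X : V) : .term (.var X) (.var X) ∈ E →
      MMAStep E (E \ {.term (.var X) (.var X)})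
  | orient (E : Set (Equation L V)) (t : L.Term V) (X : V) : .term t (.var X) ∈ E → ¬ IsVar t →
      MMAStep E ((E \ {.term t (.var X)}) ∪ {.term (.var X) t})
  | eliminate (E : Set (Equation L V)) (X : V) (t : L.Term V) :
      .term (.var X) t ∈ E → X ∉ termVars t →
      (∃ e ∈ E \ {.term (.var X) t}, X ∈ e.vars) →
      MMAStep E (Equation.subst (single X t) '' (E \ {.term (.var X) t}) ∪ {.term (.var X) t})

/-- The action that halts with failure on distinct function (or predicate) symbols is applicable. -/
def Clash (E : Set (Equation L V)) : Prop :=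
  (∃ (m n : ℕ) (f : L.Functions m) (g : L.Functions n) (s : Fin m → L.Term V)
      (t : Fin n → L.Term V), (⟨m, f⟩ : Σ k, L.Functions k) ≠ ⟨n, g⟩ ∧
      .term (.func f s) (.func g t) ∈ E) ∨
    ∃ A B : Atom L V, A.symbol ≠ B.symbol ∧ .atom A B ∈ E

/-- The action that halts with failure on a successful occur-check is applicable. -/
def OccurFailure (E : Set (Equation L V)) : Prop :=
  ∃ (X : V) (t : L.Term V), X ∈ termVars t ∧ t ≠ .var X ∧ .term (.var X) t ∈ E

/-- No action is applicable. -/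
def Final (E : Set (Equation L V)) : Prop :=
  (∀ E', ¬ MMAStep E E') ∧ ¬ Clash E ∧ ¬ OccurFailure E

/-- `E` is WNSTO: there is a run of the algorithm on `E` (a maximal sequence of actions) in which
the occur-check action is not performed. Such a run consists of non-halting actions leading from `E`
to some `E'`, after which either the algorithm halts on a clash of symbols, or no action is
applicable. -/
def WNSTO (E : Set (Equation L V)) : Prop :=
  ∃ E', Relation.ReflTransGen MMAStep E E' ∧ (Clash E' ∨ Final E')

/-- The unification `{A ≐ H}` is available in the SLD-tree for `P` with `Q` via `R`:
`A` is the selected atom of a query in the tree, `H` is the head of a standardized apart variant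
of a clause of `P`, and `A`, `H` have the same predicate symbol. -/
def Available (P : Program L V) (R : SelectionRule L V) (Q : Query L V) (A H : Atom L V) : Prop :=
  ∃ (h : List (SLDStep L V)) (i : Fin (lastQuery Q h).length) (C : Clause L V),
    Derivation P R Q h ∧ R Q h = some i ∧ InputClause P Q h C ∧
    A = (lastQuery Q h).get i ∧ H = C.head ∧ A.symbol = H.symbol

/-- `P` with `Q` is weakly occur-check free under the selection rule `R`. -/
def WeaklyOccurCheckFree (P : Program L V) (R : SelectionRule L V) (Q : Query L V) : Prop :=
  ∀ A H, Available P R Q A H → WNSTO {.atom A H}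

end OccurCheck

/-! A clause head receives its inputs and produces its outputs, so its positions play the reverse
role to those of the selected atom. Let `A` be selected and `H` be the head. In each argument
equation call one side the output: the term of `A` in an output position, the term of `H` in an
input position. The equations and the remaining atoms then form one list of nodes, each with output
and input occurrences of variables. The list is tidy if its outputs are linear and some rank on the
variables increases strictly from the inputs to the outputs of each node (`TidyNodes`). For the
atoms of a query this is tidiness (`tidyQuery_iff`).

Unification preserves tidiness of the whole list. The rank keeps the two sides of an equation
variable disjoint, so no occur-check can succeed. Decomposing an equation or eliminating a variable
leaves a tidy list (`TidyNodes.decompose`, `TidyNodes.eliminate_out`, `TidyNodes.eliminate_in`).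
Once no equation is left, the nodes are those of the resolvent. Thus a single induction,
`unifiesTidily_of_tidyNodes`, yields both claims; the choice of the mgu only matters up to a
renaming of the variables that still occur.

A weakly tidy clause can violate tidiness only through variables in the `+` positions of its head.
The equations of these positions have a ground side in `A`, so they are solved first and bind all
these variables to ground terms (`unifiesTidily_of_ground`). This prescribed order is why the result
is about some run and not about all runs. For tidiness, binding to a ground term is the same as
erasing the occurrences. That the list is tidy after the erasure is `TidyNodes.replace`: the ranks
of the clause variables are inserted between those of the inputs and those of the outputs of `A`. -/

namespace OccurCheck

/-! ### Tidy lists of nodes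

A node records the occurrences of variables in the output part and in the input part of an atom or
of an oriented equation. Acyclicity is expressed by a rank function on the variables. -/

section Nodes

variable {V : Type w} {V' : Type*}

/-- The outputs of the nodes are linear, and variables can be ranked in such a way that in each node
the inputs lie strictly below the outputs. -/
def TidyNodes (N : List (List V × List V)) : Prop :=
  (N.flatMap Prod.fst).Nodup ∧
    ∃ r : V → ℕ, ∀ n ∈ N, ∀ x ∈ n.2, ∀ y ∈ n.1, r x < r y

/-- Replace each occurrence of a variable `x` by the sequence `f x`. -/
def nodeBind (f : V → List V') (n : List V × List V) : List V' × List V' :=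
  (n.1.flatMap f, n.2.flatMap f)

theorem nodeBind_nodeBind (f g : V → List V) (n : List V × List V) :
    nodeBind g (nodeBind f n) = nodeBind (fun x => (f x).flatMap g) n := by
  simp [nodeBind, List.flatMap_assoc]

theorem flatMap_fst_map_nodeBind (f : V → List V') (N : List (List V × List V)) :
    (N.map (nodeBind f)).flatMap Prod.fst = (N.flatMap Prod.fst).flatMap f := by
  simp [List.flatMap_map, List.flatMap_assoc, nodeBind]

theorem flatMap_eq_self {f : V → List V} {l : List V} (h : ∀ x ∈ l, f x = [x]) :
    l.flatMap f = l := by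
  induction l with
  | nil => rfl
  | cons a l ih =>
    rw [List.flatMap_cons, h a (by simp), ih fun x hx => h x (by simp [hx])]
    rfl

theorem flatMap_sublist_self {f : V → List V} (h : ∀ x, (f x).Sublist [x]) (l : List V) :
    (l.flatMap f).Sublist l := by
  induction l with
  | nil => simp
  | cons a l ih => exact (h a).append ih

theorem TidyNodes.of_sublist {N N' : List (List V × List V)} (hN : TidyNodes N)
    (h : N'.Sublist N) : TidyNodes N' := by
  obtain ⟨h1, r, hr⟩ := hN
  exact ⟨h1.sublist (h.flatMap _), r, fun n hn => hr n (h.subset hn)⟩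

/-- Models the binding of variables to ground terms: occurrences only disappear, so the same rank
works. -/
theorem TidyNodes.erase {N : List (List V × List V)} (hN : TidyNodes N) {f : V → List V}
    (hf : ∀ x, (f x).Sublist [x]) : TidyNodes (N.map (nodeBind f)) := by
  obtain ⟨h1, r, hr⟩ := hN
  refine ⟨?_, r, ?_⟩
  · rw [flatMap_fst_map_nodeBind]
    exact h1.sublist (flatMap_sublist_self hf _)
  · intro n hn x hx y hy
    obtain ⟨m, hm, rfl⟩ := List.mem_map.1 hn
    exact hr m hm x ((flatMap_sublist_self hf _).subset hx) y
      ((flatMap_sublist_self hf _).subset hy)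

theorem TidyNodes.rename {N : List (List V × List V)} (hN : TidyNodes N) {ρ : V → V'}
    (hρ : ∀ x ∈ N.flatMap fun n => n.1 ++ n.2, ∀ y ∈ N.flatMap fun n => n.1 ++ n.2,
      ρ x = ρ y → x = y) :
    TidyNodes (N.map (nodeBind fun x => [ρ x])) := by
  obtain ⟨h1, r, hr⟩ := hN
  have hsub : ∀ n ∈ N, ∀ x, x ∈ n.1 ∨ x ∈ n.2 → x ∈ N.flatMap fun n => n.1 ++ n.2 := by
    intro n hn x hx
    exact List.mem_flatMap.2 ⟨n, hn, by simpa using hx⟩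
  have hmap : ∀ l : List V, (l.flatMap fun x => [ρ x]) = l.map ρ := fun _ =>
    List.map_eq_flatMap.symm
  refine ⟨?_, ?_⟩
  · rw [flatMap_fst_map_nodeBind, hmap]
    refine List.Nodup.map_on (fun x hx y hy h => ?_) h1
    obtain ⟨n, hn, hx⟩ := List.mem_flatMap.1 hx
    obtain ⟨m, hm, hy⟩ := List.mem_flatMap.1 hy
    exact hρ x (hsub n hn x (.inl hx)) y (hsub m hm y (.inl hy)) h
  · classical
    -- The rank is transported along a chosen preimage; the value 0 off the image is never used.
    let s : V' → ℕ := fun z =>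
      if h : ∃ x ∈ N.flatMap fun n => n.1 ++ n.2, ρ x = z then r h.choose else 0
    have hs : ∀ x ∈ N.flatMap fun n => n.1 ++ n.2, s (ρ x) = r x := by
      intro x hx
      have h : ∃ y ∈ N.flatMap fun n => n.1 ++ n.2, ρ y = ρ x := ⟨x, hx, rfl⟩
      have := hρ _ h.choose_spec.1 x hx h.choose_spec.2
      simp only [s, dif_pos h, this]
    refine ⟨s, fun n hn x hx y hy => ?_⟩
    obtain ⟨m, hm, rfl⟩ := List.mem_map.1 hn
    simp only [nodeBind, hmap, List.mem_map] at hx hy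
    obtain ⟨x, hx, rfl⟩ := hx
    obtain ⟨y, hy, rfl⟩ := hy
    rw [hs x (hsub m hm x (.inr hx)), hs y (hsub m hm y (.inl hy))]
    exact hr m hm x hx y hy

/-- Elimination of an output variable. -/
theorem TidyNodes.eliminate_out {N : List (List V × List V)} {X : V} {T : List V}
    (hN : TidyNodes (([X], T) :: N)) {f : V → List V} (hX : f X = T)
    (hf : ∀ x, x ≠ X → f x = [x]) : TidyNodes (N.map (nodeBind f)) := by
  obtain ⟨h1, r, hr⟩ := hN
  simp only [List.flatMap_cons, List.singleton_append, List.nodup_cons] at h1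
  -- By linearity `X` is an output of the removed node only, so the substitution changes inputs
  -- alone. It replaces `X` there by variables of smaller rank, and the old rank survives.
  have hout : ∀ n ∈ N, n.1.flatMap f = n.1 := by
    intro n hn
    refine flatMap_eq_self fun x hx => hf x ?_
    rintro rfl
    exact h1.1 (List.mem_flatMap.2 ⟨n, hn, hx⟩)
  refine ⟨?_, r, ?_⟩
  · rw [flatMap_fst_map_nodeBind, flatMap_eq_self]
    · exact h1.2
    · rintro x hx
      refine hf x ?_
      rintro rfl
      exact h1.1 hx
  · intro n hn x hx y hy
    obtain ⟨m, hm, rfl⟩ := List.mem_map.1 hn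
    simp only [nodeBind, hout m hm, List.mem_flatMap] at hx hy
    obtain ⟨x₀, hx₀, hx⟩ := hx
    have h := hr m (by simp [hm]) x₀ hx₀ y hy
    by_cases hxX : x₀ = X
    · subst hxX
      rw [hX] at hx
      exact (hr ([x₀], T) List.mem_cons_self x hx x₀ List.mem_cons_self).trans h
    · rw [hf _ hxX, List.mem_singleton] at hx
      exact hx ▸ h

/-- Elimination of an input variable. -/
theorem TidyNodes.eliminate_in {N : List (List V × List V)} {X : V} {T : List V}
    (hN : TidyNodes ((T, [X]) :: N)) {f : V → List V} (hX : f X = T)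
    (hf : ∀ x, x ≠ X → f x = [x]) : TidyNodes (N.map (nodeBind f)) := by
  classical
  obtain ⟨h1, r, hr⟩ := hN
  simp only [List.flatMap_cons, List.nodup_append'] at h1
  obtain ⟨hT, hout, hdis⟩ := h1
  have hrT : ∀ y ∈ T, r X < r y := fun y hy =>
    hr (T, [X]) List.mem_cons_self X List.mem_cons_self y hy
  -- The variables of `T` are lowered to the rank of `X`. This does no harm to inputs. As an output,
  -- a variable of `T` can now only stem from the former output `X`, because the outputs were
  -- linear.
  refine ⟨?_, fun y => if y ∈ T then r X else r y, ?_⟩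
  · rw [flatMap_fst_map_nodeBind, List.nodup_flatMap]
    constructor
    · intro x _
      by_cases hx : x = X
      · rwa [hx, hX]
      · simp [hf x hx]
    · refine hout.imp_of_mem ?_
      intro a b ha hb hab
      simp only [Function.onFun]
      by_cases haX : a = X
      · subst haX
        rw [hX, hf b (Ne.symm hab)]
        intro z hz hz'
        rw [List.mem_singleton] at hz'
        exact hdis hz (hz' ▸ hb)
      · rw [hf a haX]
        intro z hz hz'
        rw [List.mem_singleton] at hz
        subst hz
        by_cases hbX : b = X
        · rw [hbX, hX] at hz'
          exact hdis hz' ha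
        · rw [hf b hbX, List.mem_singleton] at hz'
          exact hab hz'
  · intro n hn x hx y hy
    obtain ⟨m, hm, rfl⟩ := List.mem_map.1 hn
    simp only [nodeBind, List.mem_flatMap] at hx hy
    obtain ⟨x₀, hx₀, hx⟩ := hx
    obtain ⟨y₀, hy₀, hy⟩ := hy
    have h := hr m (by simp [hm]) x₀ hx₀ y₀ hy₀
    have hxr : (if x ∈ T then r X else r x) ≤ r x₀ := by
      by_cases hxX : x₀ = X
      · rw [hxX, hX] at hx
        rw [if_pos hx, hxX]
      · rw [hf _ hxX, List.mem_singleton] at hx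
        subst hx
        split_ifs with hxT
        · exact (hrT x hxT).le
        · exact le_rfl
    have hyr : (if y ∈ T then r X else r y) = r y₀ := by
      by_cases hyX : y₀ = X
      · rw [hyX, hX] at hy
        rw [if_pos hy, hyX]
      · rw [hf _ hyX, List.mem_singleton] at hy
        subst hy
        rw [if_neg fun hyT => hdis hyT (List.mem_flatMap.2 ⟨m, hm, hy₀⟩)]
    simp only [hyr]
    exact hxr.trans_lt h

/-- A node may be split into several nodes. -/
theorem TidyNodes.decompose {N : List (List V × List V)} {k : ℕ} {o i : Fin k → List V}
    (hN : TidyNodes (((List.ofFn o).flatten, (List.ofFn i).flatten) :: N)) :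
    TidyNodes (List.ofFn (fun j => (o j, i j)) ++ N) := by
  obtain ⟨h1, r, hr⟩ := hN
  refine ⟨?_, r, ?_⟩
  · convert h1 using 1
    rw [List.flatMap_append, List.flatMap_cons]
    congr 1
    rw [List.flatMap_def, List.map_ofFn]
    rfl
  · intro n hn x hx y hy
    rcases List.mem_append.1 hn with hn | hn
    · obtain ⟨j, rfl⟩ := List.mem_ofFn.1 hn
      refine hr _ List.mem_cons_self x ?_ y ?_
      · exact List.mem_flatten.2 ⟨_, List.mem_ofFn.2 ⟨j, rfl⟩, hx⟩
      · exact List.mem_flatten.2 ⟨_, List.mem_ofFn.2 ⟨j, rfl⟩, hy⟩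
    · exact hr n (List.mem_cons_of_mem _ hn) x hx y hy

/-- Replacing a node of a tidy list by a variable disjoint tidy list `NB`, and by nodes `I` that
link the inputs of the removed node with `hin`, and its outputs with variables of `c`. -/
theorem TidyNodes.replace {N₁ N₂ NB I : List (List V × List V)} {o i hin c : List V}
    (hQ : TidyNodes (N₁ ++ (o, i) :: N₂)) (hB : TidyNodes NB)
    (hnd : (hin ++ NB.flatMap Prod.fst).Nodup)
    (hc : ∀ n ∈ NB, ∀ x, x ∈ n.1 ∨ x ∈ n.2 → x ∈ c) (hinc : ∀ x ∈ hin, x ∈ c)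
    (hdis : ∀ n ∈ N₁ ++ (o, i) :: N₂, ∀ x, x ∈ n.1 ∨ x ∈ n.2 → x ∉ c)
    (hI : I.flatMap Prod.fst = hin ++ o)
    (hI2 : ∀ n ∈ I, (n.1 ⊆ hin ∧ n.2 ⊆ i) ∨ (n.1 ⊆ o ∧ n.2 ⊆ c)) :
    TidyNodes (I ++ (N₁ ++ NB ++ N₂)) := by
  classical
  obtain ⟨hQ1, r₁, hr₁⟩ := hQ
  obtain ⟨-, r₂, hr₂⟩ := hB
  have hoi : (o, i) ∈ N₁ ++ (o, i) :: N₂ := by simp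
  refine ⟨?_, ?_⟩
  · have hp : ((I ++ (N₁ ++ NB ++ N₂)).flatMap Prod.fst).Perm
        ((N₁ ++ (o, i) :: N₂).flatMap Prod.fst ++ (hin ++ NB.flatMap Prod.fst)) := by
      simp only [List.flatMap_append, hI, List.flatMap_cons]
      rw [List.perm_iff_count]
      intro a
      simp only [List.count_append]
      omega
    rw [hp.nodup_iff, List.nodup_append']
    refine ⟨hQ1, hnd, fun x hx hx' => ?_⟩
    obtain ⟨n, hn, hx⟩ := List.mem_flatMap.1 hx
    refine hdis n hn x (.inl hx) ?_
    rcases List.mem_append.1 hx' with hx' | hx'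
    · exact hinc x hx'
    · obtain ⟨m, hm, hx'⟩ := List.mem_flatMap.1 hx'
      exact hc m hm x (.inl hx')
  -- `m` separates the inputs of the removed node (below `m`) from its outputs (at least `m`).
  -- Clause variables get ranks in `[m, m + b]`, and query variables of rank at least `m` are
  -- shifted up by `b + 1` to make room.
  · let m := i.toFinset.sup fun x => r₁ x + 1
    let b := c.toFinset.sup r₂
    let r : V → ℕ := fun x =>
      if x ∈ c then m + r₂ x else if r₁ x < m then r₁ x else r₁ x + b + 1
    have hrc : ∀ x ∈ c, m ≤ r x ∧ r x ≤ m + b := by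
      intro x hx
      have : r₂ x ≤ b := Finset.le_sup (f := r₂) (List.mem_toFinset.2 hx)
      simp only [r, if_pos hx]
      omega
    have hri : ∀ x ∈ i, r x < m := by
      intro x hx
      have h : r₁ x + 1 ≤ m :=
        Finset.le_sup (f := fun x => r₁ x + 1) (List.mem_toFinset.2 hx)
      have hxc := hdis _ hoi x (.inr hx)
      simp only [r, if_neg hxc]
      rw [if_pos (by omega)]
      omega
    have hro : ∀ x ∈ o, m + b < r x := by
      intro x hx
      have h : m ≤ r₁ x := Finset.sup_le fun y hy =>
        hr₁ _ hoi y (List.mem_toFinset.1 hy) x hx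
      have hxc := hdis _ hoi x (.inl hx)
      simp only [r, if_neg hxc]
      rw [if_neg (by omega)]
      omega
    have hrQ : ∀ n ∈ N₁ ++ (o, i) :: N₂, ∀ x ∈ n.2, ∀ y ∈ n.1, r x < r y := by
      intro n hn x hx y hy
      have h := hr₁ n hn x hx y hy
      simp only [r, if_neg (hdis n hn x (.inr hx)), if_neg (hdis n hn y (.inl hy))]
      split_ifs <;> omega
    refine ⟨r, fun n hn x hx y hy => ?_⟩
    simp only [List.mem_append] at hn
    rcases hn with hn | (hn | hn) | hn
    · rcases hI2 n hn with ⟨h1, h2⟩ | ⟨h1, h2⟩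
      · exact (hri x (h2 hx)).trans_le (hrc y (hinc y (h1 hy))).1
      · exact (hrc x (h2 hx)).2.trans_lt (hro y (h1 hy))
    · exact hrQ n (by simp [hn]) x hx y hy
    · simp only [r, if_pos (hc n hn x (.inr hx)), if_pos (hc n hn y (.inl hy))]
      have := hr₂ n hn x hx y hy
      omega
    · exact hrQ n (by simp [hn]) x hx y hy

/-- A list of nodes without cycles of variables has a rank function. -/
theorem exists_rank {N : List (List V × List V)}
    (h : ∀ x, ¬ Relation.TransGen (fun x y => ∃ n ∈ N, x ∈ n.2 ∧ y ∈ n.1) x x) :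
    ∃ r : V → ℕ, ∀ n ∈ N, ∀ x ∈ n.2, ∀ y ∈ n.1, r x < r y := by
  classical
  let F : Finset V := (N.flatMap fun n => n.1 ++ n.2).toFinset
  let e : V → V → Prop := fun x y => ∃ n ∈ N, x ∈ n.2 ∧ y ∈ n.1
  -- The rank counts the predecessors. Along an edge from `x` to `y` the predecessors of `x` are
  -- inherited and `x` itself is new, by acyclicity.
  refine ⟨fun x => (F.filter fun z => Relation.TransGen e z x).card, fun n hn x hx y hy => ?_⟩
  have hxy : e x y := ⟨n, hn, hx, hy⟩
  refine Finset.card_lt_card ((Finset.ssubset_iff_of_subset ?_).2 ⟨x, ?_, ?_⟩)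
  · intro z hz
    rw [Finset.mem_filter] at hz ⊢
    exact ⟨hz.1, hz.2.tail hxy⟩
  · refine Finset.mem_filter.2 ⟨?_, .single hxy⟩
    exact List.mem_toFinset.2 (List.mem_flatMap.2 ⟨n, hn, by simp [hx]⟩)
  · exact fun hz => h x (Finset.mem_filter.1 hz).2

end Nodes

variable {L : FirstOrder.Language.{u, v}} {V : Type w}

/-! ### Terms and substitutions -/

theorem mem_termVars {x : V} {t : L.Term V} : x ∈ termVars t ↔ x ∈ termOccs t := Iff.rfl

@[simp] theorem termOccs_var (x : V) : termOccs (L := L) (.var x) = [x] := by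
  rw [termOccs]

@[simp] theorem termOccs_func {n : ℕ} (f : L.Functions n) (ts : Fin n → L.Term V) :
    termOccs (.func f ts) = (List.ofFn fun i => termOccs (ts i)).flatten := by
  rw [termOccs]

theorem mem_termVars_func {n : ℕ} {f : L.Functions n} {ts : Fin n → L.Term V} {x : V} :
    x ∈ termVars (.func f ts) ↔ ∃ i, x ∈ termVars (ts i) := by
  simp [mem_termVars, List.mem_ofFn]

theorem isGround_iff {t : L.Term V} : IsGround t ↔ termOccs t = [] := by
  rw [IsGround, Set.eq_empty_iff_forall_notMem, List.eq_nil_iff_forall_not_mem]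
  rfl

theorem termOccs_subst (t : L.Term V) (f : V → L.Term V) :
    termOccs (t.subst f) = (termOccs t).flatMap fun x => termOccs (f x) := by
  induction t with
  | var x => simp [FirstOrder.Language.Term.subst]
  | func g ts ih =>
    simp only [FirstOrder.Language.Term.subst, termOccs_func, ih, List.flatMap_def,
      List.map_flatten, List.map_ofFn]
    rw [List.flatten_flatten, List.map_ofFn]
    rfl

theorem mem_termVars_subst {t : L.Term V} {f : V → L.Term V} {y : V} :
    y ∈ termVars (t.subst f) ↔ ∃ x ∈ termVars t, y ∈ termVars (f x) := by
  simp [mem_termVars, termOccs_subst]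

theorem subst_congr {t : L.Term V} {f g : V → L.Term V} (h : ∀ x ∈ termVars t, f x = g x) :
    t.subst f = t.subst g := by
  induction t with
  | var x => exact h x (by simp [mem_termVars])
  | func k ts ih =>
    simp only [FirstOrder.Language.Term.subst]
    congr 1
    funext i
    exact ih i fun x hx => h x (mem_termVars_func.2 ⟨i, hx⟩)

theorem subst_var (t : L.Term V) : t.subst .var = t := by
  induction t with
  | var x => rfl
  | func k ts ih => simp only [FirstOrder.Language.Term.subst, ih]

theorem subst_subst (t : L.Term V) (f g : V → L.Term V) :
    (t.subst f).subst g = t.subst fun x => (f x).subst g := by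
  induction t with
  | var x => rfl
  | func k ts ih => simp only [FirstOrder.Language.Term.subst, ih]

theorem subst_eq_self {t : L.Term V} {f : V → L.Term V} (h : ∀ x ∈ termVars t, f x = .var x) :
    t.subst f = t :=
  (subst_congr h).trans (subst_var t)

@[simp] theorem single_same (X : V) (t : L.Term V) : single X t X = t := by
  simp [single]

theorem single_of_ne {X x : V} (t : L.Term V) (h : x ≠ X) : single X t x = .var x := by
  classical
  exact Function.update_of_ne h _ _

theorem subst_single_eq_self {X : V} {t s : L.Term V} (h : X ∉ termVars s) :
    s.subst (single X t) = s :=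
  subst_eq_self fun _ hx => single_of_ne t fun hxX => h (hxX ▸ hx)

theorem mem_termVars_subst_single {X y : V} {t s : L.Term V} (ht : X ∉ termVars t)
    (h : y ∈ termVars (s.subst (single X t))) :
    y ≠ X ∧ (y ∈ termVars s ∨ y ∈ termVars t ∧ X ∈ termVars s) := by
  obtain ⟨x, hx, hy⟩ := mem_termVars_subst.1 h
  by_cases hxX : x = X
  · subst hxX
    rw [single_same] at hy
    exact ⟨fun h => ht (h ▸ hy), .inr ⟨hy, hx⟩⟩
  · rw [single_of_ne t hxX, mem_termVars, termOccs_var, List.mem_singleton] at hy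
    subst hy
    exact ⟨hxX, .inl hx⟩

/-- The substitution `{X/t}τ`. -/
noncomputable def Subst.singleComp (X : V) (t : L.Term V) (τ : Subst L V) : Subst L V where
  map x := (single X t x).subst τ.map
  finite_dom := by
    refine (τ.finite_dom.insert X).subset fun x hx => ?_
    by_cases h : x = X
    · exact .inl h
    · refine .inr ?_
      simpa [single_of_ne t h, FirstOrder.Language.Term.subst] using hx

variable (L V) in
/-- The empty substitution. -/
def Subst.id : Subst L V := ⟨.var, by simp⟩

/-! ### Atoms and queries as nodes -/

/-- The occurrences of variables in the output and in the input positions of an atom. -/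
def Atom.node (M : Moding L) (A : Atom L V) : List V × List V :=
  ((outTerms M A).flatMap termOccs, (inTerms M A).flatMap termOccs)

theorem mem_varOut {M : Moding L} {A : Atom L V} {x : V} :
    x ∈ varOut M A ↔ x ∈ (A.node M).1 := by
  simp [varOut, Atom.node, mem_termVars]

theorem mem_varIn {M : Moding L} {A : Atom L V} {x : V} :
    x ∈ varIn M A ↔ x ∈ (A.node M).2 := by
  simp [varIn, Atom.node, mem_termVars]

theorem mem_vars_of_mem_node {M : Moding L} {A : Atom L V} {x : V}
    (h : x ∈ (A.node M).1 ∨ x ∈ (A.node M).2) : x ∈ A.vars := by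
  simp only [Atom.node, outTerms, inTerms, List.mem_flatMap, List.mem_map] at h
  rcases h with ⟨_, ⟨i, _, rfl⟩, hx⟩ | ⟨_, ⟨i, _, rfl⟩, hx⟩ <;> exact ⟨i, hx⟩

theorem Atom.node_subst (M : Moding L) (A : Atom L V) (f : V → L.Term V) :
    (A.subst f).node M = nodeBind (fun x => termOccs (f x)) (A.node M) := by
  simp [Atom.node, nodeBind, outTerms, inTerms, Atom.subst, List.flatMap_map,
    List.flatMap_assoc, termOccs_subst]
  exact ⟨rfl, rfl⟩

theorem map_node_querySubst (M : Moding L) (Q : Query L V) (f : V → L.Term V) :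
    (querySubst Q f).map (Atom.node M) =
      (Q.map (Atom.node M)).map (nodeBind fun x => termOccs (f x)) := by
  simp [querySubst, Atom.node_subst]

theorem mem_atom_vars_subst {A : Atom L V} {f : V → L.Term V} {y : V} :
    y ∈ (A.subst f).vars ↔ ∃ x ∈ A.vars, y ∈ termVars (f x) := by
  constructor
  · rintro ⟨i, hi⟩
    obtain ⟨x, hx, hy⟩ := mem_termVars_subst.1 hi
    exact ⟨x, ⟨i, hx⟩, hy⟩
  · rintro ⟨x, ⟨i, hx⟩, hy⟩
    exact ⟨i, mem_termVars_subst.2 ⟨x, hx, hy⟩⟩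

theorem mem_queryVars_querySubst {Q : Query L V} {f : V → L.Term V} {y : V} :
    y ∈ queryVars (querySubst Q f) ↔ ∃ x ∈ queryVars Q, y ∈ termVars (f x) := by
  constructor
  · rintro ⟨B, hB, hy⟩
    obtain ⟨A, hA, rfl⟩ := List.mem_map.1 hB
    obtain ⟨x, hx, hy⟩ := mem_atom_vars_subst.1 hy
    exact ⟨x, ⟨A, hA, hx⟩, hy⟩
  · rintro ⟨x, ⟨A, hA, hx⟩, hy⟩
    exact ⟨_, List.mem_map.2 ⟨A, hA, rfl⟩, mem_atom_vars_subst.2 ⟨x, hx, hy⟩⟩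

theorem querySubst_querySubst (Q : Query L V) (f g : V → L.Term V) :
    querySubst (querySubst Q f) g = querySubst Q fun x => (f x).subst g := by
  simp [querySubst, Atom.subst, subst_subst]

/-- Acyclicity on atoms and on variables agree: a path of variables passes from an input to an
output within each atom, a path of atoms passes from an output to an input along a shared variable.
So a cycle of one kind gives a cycle of the other, and `exists_rank` turns acyclicity into a rank.
-/
theorem tidyQuery_iff {M : Moding L} {Q : Query L V} :
    TidyQuery M Q ↔ TidyNodes (Q.map (Atom.node M)) := by
  have hlin : LinearSeq (Q.flatMap (outTerms M)) ↔
      ((Q.map (Atom.node M)).flatMap Prod.fst).Nodup := by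
    rw [LinearSeq, List.flatMap_assoc, List.flatMap_map]
    rfl
  rw [TidyQuery, TidyNodes, hlin]
  refine and_congr_right fun _ => ⟨fun h => exists_rank fun x hx => ?_, ?_⟩
  · have key : ∀ y, Relation.TransGen
        (fun x y => ∃ n ∈ Q.map (Atom.node M), x ∈ n.2 ∧ y ∈ n.1) x y →
        ∃ A ∈ Q, ∃ B ∈ Q, x ∈ varIn M A ∧ y ∈ varOut M B ∧
          Relation.ReflTransGen (arrow M Q) A B := by
      intro y hy
      induction hy with
      | single h =>
        obtain ⟨n, hn, h1, h2⟩ := h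
        obtain ⟨A, hA, rfl⟩ := List.mem_map.1 hn
        exact ⟨A, hA, A, hA, mem_varIn.2 h1, mem_varOut.2 h2, .refl⟩
      | tail _ h ih =>
        obtain ⟨A, hA, B, hB, hx, hy, hAB⟩ := ih
        obtain ⟨n, hn, h1, h2⟩ := h
        obtain ⟨C, hC, rfl⟩ := List.mem_map.1 hn
        exact ⟨A, hA, C, hC, hx, mem_varOut.2 h2,
          hAB.tail ⟨hB, hC, _, hy, mem_varIn.2 h1⟩⟩
    obtain ⟨A, hA, B, hB, hxA, hxB, hAB⟩ := key x hx
    exact h B hB (.head' ⟨hB, hA, x, hxB, hxA⟩ hAB)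
  · rintro ⟨r, hr⟩ A hA hAA
    have hr' : ∀ B ∈ Q, ∀ x ∈ varIn M B, ∀ y ∈ varOut M B, r x < r y := fun B hB x hx y hy =>
      hr _ (List.mem_map.2 ⟨B, hB, rfl⟩) x (mem_varIn.1 hx) y (mem_varOut.1 hy)
    -- The rank cannot drop between an output of `A` and an input of `B`. For `B = A` this
    -- contradicts the strict increase from inputs to outputs.
    have key : ∀ B, Relation.TransGen (arrow M Q) A B →
        ∃ x ∈ varOut M A, ∃ y ∈ varIn M B, r x ≤ r y := by
      intro B hB
      induction hB with
      | single h =>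
        obtain ⟨-, -, x, h1, h2⟩ := h
        exact ⟨x, h1, x, h2, le_rfl⟩
      | tail _ h ih =>
        obtain ⟨x, hx, y, hy, hxy⟩ := ih
        obtain ⟨hB, -, z, h1, h2⟩ := h
        exact ⟨x, hx, z, h2, hxy.trans (hr' _ hB y hy z h1).le⟩
    obtain ⟨x, hx, y, hy, hxy⟩ := key A hAA
    exact absurd (hr' A hA y hy x hx) (by omega)

/-! ### Equations -/

theorem mem_equation_vars_subst {e : Equation L V} {f : V → L.Term V} {y : V} :
    y ∈ (e.subst f).vars ↔ ∃ x ∈ e.vars, y ∈ termVars (f x) := by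
  cases e with
  | term s t =>
    simp only [Equation.subst, Equation.vars, Set.mem_union, mem_termVars_subst]
    aesop
  | atom A B =>
    simp only [Equation.subst, Equation.vars, Set.mem_union, mem_atom_vars_subst]
    aesop

theorem mem_equation_vars_subst_single {X y : V} {t : L.Term V} {e : Equation L V}
    (ht : X ∉ termVars t) (h : y ∈ (e.subst (single X t)).vars) :
    y ≠ X ∧ (y ∈ e.vars ∨ y ∈ termVars t) := by
  obtain ⟨x, hx, hy⟩ := mem_equation_vars_subst.1 h
  by_cases hxX : x = X
  · subst hxX
    rw [single_same] at hy
    exact ⟨fun h => ht (h ▸ hy), .inr hy⟩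
  · rw [single_of_ne t hxX, mem_termVars, termOccs_var, List.mem_singleton] at hy
    subst hy
    exact ⟨hxX, .inl hx⟩

theorem equation_subst_single_eq_self {X : V} {t : L.Term V} {e : Equation L V}
    (h : X ∉ e.vars) : e.subst (single X t) = e := by
  cases e with
  | term a b =>
    simp only [Equation.vars, Set.mem_union, not_or] at h
    simp only [Equation.subst, subst_single_eq_self h.1, subst_single_eq_self h.2]
  | atom A B =>
    simp only [Equation.vars, Set.mem_union, not_or] at h
    have key : ∀ C : Atom L V, X ∉ C.vars → C.subst (single X t) = C := fun C hC => by
      have : (fun i => (C.args i).subst (single X t)) = C.args :=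
        funext fun i => subst_single_eq_self fun hi => hC ⟨i, hi⟩
      simp only [Atom.subst, this]
    simp only [Equation.subst, key A h.1, key B h.2]

/-! ### Invariant of a run: solved equations next to unsolved ones -/

/-- `f` unifies both sides of the equation. -/
def Equation.Unifies (f : V → L.Term V) : Equation L V → Prop
  | .term s t => s.subst f = t.subst f
  | .atom A B => A.subst f = B.subst f

theorem Equation.unifies_subst {e : Equation L V} {f g : V → L.Term V} :
    (e.subst f).Unifies g ↔ e.Unifies fun x => (f x).subst g := by
  cases e <;> simp [Equation.Unifies, Equation.subst, Atom.subst, subst_subst]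

/-- Each equation of `S` is of the form `X ≐ t`, where `X` occurs neither in `t` nor elsewhere in
`S ∪ U`. -/
def Solved (S U : Set (Equation L V)) : Prop :=
  ∀ e ∈ S, ∃ (X : V) (t : L.Term V), e = .term (.var X) t ∧ X ∉ termVars t ∧
    (∀ e' ∈ U, X ∉ e'.vars) ∧ ∀ e' ∈ S, e' ≠ e → X ∉ e'.vars

def equationVars (U : Set (Equation L V)) : Set V := {x | ∃ e ∈ U, x ∈ e.vars}

/-- The equations `U` have a run without the occur-check action, also next to solved equations, and
applying to the query `K` a most general unifier of `U` leads to a tidy query. -/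
def UnifiesTidily (M : Moding L) (U : Set (Equation L V)) (K : Query L V) : Prop :=
  (∀ S, Solved S U → WNSTO (S ∪ U)) ∧
    ∀ θ : Subst L V, (∀ e ∈ U, e.Unifies θ.map) →
      (∀ τ : Subst L V, (∀ e ∈ U, e.Unifies τ.map) →
        ∃ η : Subst L V, ∀ x ∈ equationVars U ∪ queryVars K,
          (θ.map x).subst η.map = τ.map x) →
      TidyQuery M (querySubst K θ.map)

theorem WNSTO.of_step {E E' : Set (Equation L V)} (h : MMAStep E E') (hE : WNSTO E') :
    WNSTO E := by
  obtain ⟨E'', h1, h2⟩ := hE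
  exact ⟨E'', .head h h1, h2⟩

theorem Solved.notMem {S U : Set (Equation L V)} (h : Solved S U) {e : Equation L V}
    (he : e ∈ U) : e ∉ S := by
  intro heS
  obtain ⟨X, t, rfl, -, h1, -⟩ := h e heS
  exact h1 _ he (.inl (by simp [mem_termVars]))

theorem Solved.mono {S U U' : Set (Equation L V)} (h : Solved S U)
    (hU : equationVars U' ⊆ equationVars U) : Solved S U' := by
  intro e he
  obtain ⟨X, t, h0, h1, h2, h3⟩ := h e he
  refine ⟨X, t, h0, h1, fun e' he' hX => ?_, h3⟩
  obtain ⟨e'', he'', hX'⟩ := hU ⟨e', he', hX⟩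
  exact h2 e'' he'' hX'

theorem Solved.sdiff_union {S U R : Set (Equation L V)} (h : Solved S U) (hR : R ⊆ U) :
    (S ∪ U) \ R = S ∪ U \ R := by
  rw [Set.union_sdiff_distrib]
  congr 1
  exact sdiff_eq_left.2 (Set.disjoint_left.2 fun e he he' => h.notMem (hR he') he)

theorem final_of_solved {S U : Set (Equation L V)} (h : Solved S U) : Final S := by
  refine ⟨fun E' hE' => ?_, ?_, ?_⟩
  · cases hE' with
    | decomposeTerm n f s t he => obtain ⟨X, t, h1, -⟩ := h _ he; simp at h1
    | decomposeAtom n p s t he => obtain ⟨X, t, h1, -⟩ := h _ he; simp at h1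
    | delete X he =>
      obtain ⟨Y, t, h1, h2, -⟩ := h _ he
      simp only [Equation.term.injEq, FirstOrder.Language.Term.var.injEq] at h1
      obtain ⟨rfl, rfl⟩ := h1
      exact h2 (by simp [mem_termVars])
    | orient t X he ht =>
      obtain ⟨Y, s, h1, -⟩ := h _ he
      simp only [Equation.term.injEq] at h1
      exact ht ⟨Y, h1.1⟩
    | eliminate X t he _ hX =>
      obtain ⟨Y, s, h1, -, -, h2⟩ := h _ he
      simp only [Equation.term.injEq, FirstOrder.Language.Term.var.injEq] at h1
      obtain ⟨rfl, rfl⟩ := h1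
      obtain ⟨e, he, hXe⟩ := hX
      exact h2 e he.1 he.2 hXe
  · rintro (⟨m, n, f, g, s, t, -, he⟩ | ⟨A, B, -, he⟩)
    · obtain ⟨X, t, h1, -⟩ := h _ he; simp at h1
    · obtain ⟨X, t, h1, -⟩ := h _ he; simp at h1
  · rintro ⟨X, t, hX, -, he⟩
    obtain ⟨Y, s, h1, h2, -⟩ := h _ he
    simp only [Equation.term.injEq, FirstOrder.Language.Term.var.injEq] at h1
    obtain ⟨rfl, rfl⟩ := h1
    exact h2 hX

/-- With nothing left to unify, the identity is a unifier and factors through `θ`. Hence `θ` renames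
the variables of `K` injectively, which preserves tidiness. -/
theorem unifiesTidily_empty {M : Moding L} {K : Query L V} (hK : TidyNodes (K.map (Atom.node M))) :
    UnifiesTidily M ∅ K := by
  refine ⟨fun S hS => ?_, fun θ _ hθ => ?_⟩
  · rw [Set.union_empty]
    exact ⟨S, .refl, .inr (final_of_solved hS)⟩
  · obtain ⟨η, hη⟩ := hθ (Subst.id L V) (by simp)
    have hvar : ∀ x ∈ queryVars K, ∃ y, θ.map x = .var y := by
      intro x hx
      have h := hη x (.inr hx)
      cases hx' : θ.map x with
      | var y => exact ⟨y, rfl⟩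
      | func f ts =>
        rw [hx'] at h
        simp [FirstOrder.Language.Term.subst, Subst.id] at h
    classical
    have : ∀ x, ∃ y, x ∈ queryVars K → θ.map x = .var y := fun x => by
      by_cases hx : x ∈ queryVars K
      · obtain ⟨y, hy⟩ := hvar x hx
        exact ⟨y, fun _ => hy⟩
      · exact ⟨x, fun h => absurd h hx⟩
    choose ρ hρ using this
    have hmem : ∀ n ∈ K.map (Atom.node M), ∀ x, x ∈ n.1 ∨ x ∈ n.2 → x ∈ queryVars K := by
      intro n hn x hx
      obtain ⟨A, hA, rfl⟩ := List.mem_map.1 hn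
      exact ⟨A, hA, mem_vars_of_mem_node hx⟩
    have hmem' : ∀ x ∈ (K.map (Atom.node M)).flatMap fun n => n.1 ++ n.2, x ∈ queryVars K := by
      intro x hx
      obtain ⟨n, hn, hx⟩ := List.mem_flatMap.1 hx
      exact hmem n hn x (by simpa using hx)
    rw [tidyQuery_iff, map_node_querySubst]
    have heq : (K.map (Atom.node M)).map (nodeBind fun x => termOccs (θ.map x)) =
        (K.map (Atom.node M)).map (nodeBind fun x => [ρ x]) := by
      refine List.map_congr_left fun n hn => ?_
      have hl : ∀ l : List V, (∀ x ∈ l, x ∈ queryVars K) →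
          (l.flatMap fun x => termOccs (θ.map x)) = l.flatMap fun x => [ρ x] := by
        intro l hl
        refine List.flatMap_congr fun x hx => ?_
        rw [hρ x (hl x hx), termOccs_var]
      simp only [nodeBind]
      rw [hl _ fun x hx => hmem n hn x (.inl hx), hl _ fun x hx => hmem n hn x (.inr hx)]
    rw [heq]
    refine hK.rename fun x hx y hy hxy => ?_
    have h1 := hη x (.inr (hmem' x hx))
    have h2 := hη y (.inr (hmem' y hy))
    rw [hρ x (hmem' x hx)] at h1
    rw [hρ y (hmem' y hy), ← hxy, h1] at h2
    simpa [Subst.id] using h2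

/-! ### Single actions of the algorithm, read backwards -/

theorem UnifiesTidily.of_step {M : Moding L} {U U' : Set (Equation L V)} {K : Query L V}
    (hstep : ∀ S, Solved S U → MMAStep (S ∪ U) (S ∪ U'))
    (hvars : equationVars U' ⊆ equationVars U)
    (huni : ∀ θ : V → L.Term V, (∀ e ∈ U, e.Unifies θ) ↔ ∀ e ∈ U', e.Unifies θ)
    (h : UnifiesTidily M U' K) : UnifiesTidily M U K := by
  refine ⟨fun S hS => .of_step (hstep S hS) (h.1 S (hS.mono hvars)), fun θ hθ hmgu => ?_⟩
  refine h.2 θ ((huni _).1 hθ) fun τ hτ => ?_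
  obtain ⟨η, hη⟩ := hmgu τ ((huni _).2 hτ)
  exact ⟨η, fun x hx => hη x (hx.imp (fun h => hvars h) fun h => h)⟩

/-- A clash ends the run without an occur-check, and the claim on unifiers is vacuous. -/
theorem UnifiesTidily.of_clash {M : Moding L} {U : Set (Equation L V)} {K : Query L V}
    {m n : ℕ} {f : L.Functions m} {g : L.Functions n} {s : Fin m → L.Term V}
    {t : Fin n → L.Term V} (hfg : (⟨m, f⟩ : Σ k, L.Functions k) ≠ ⟨n, g⟩)
    (he : .term (.func f s) (.func g t) ∈ U) : UnifiesTidily M U K := by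
  refine ⟨fun S _ => ⟨_, .refl, .inl (.inl ⟨m, n, f, g, s, t, hfg, .inr he⟩)⟩, fun θ hθ => ?_⟩
  have h := hθ _ he
  simp only [Equation.Unifies, FirstOrder.Language.Term.subst,
    FirstOrder.Language.Term.func.injEq] at h
  obtain ⟨rfl, h, -⟩ := h
  exact absurd (congrArg _ (eq_of_heq h)) hfg

theorem UnifiesTidily.of_decomposeTerm {M : Moding L} {U : Set (Equation L V)} {K : Query L V}
    {n : ℕ} {f : L.Functions n} {s t : Fin n → L.Term V}
    (he : .term (.func f s) (.func f t) ∈ U)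
    (h : UnifiesTidily M
      ((U \ {.term (.func f s) (.func f t)}) ∪ Set.range fun i => .term (s i) (t i)) K) :
    UnifiesTidily M U K := by
  refine h.of_step (fun S hS => ?_) ?_ fun θ => ?_
  · rw [← Set.union_assoc, ← hS.sdiff_union (Set.singleton_subset_iff.2 he)]
    exact .decomposeTerm _ n f s t (.inr he)
  · rintro x ⟨e, (he' | ⟨i, rfl⟩), hx⟩
    · exact ⟨e, he'.1, hx⟩
    · exact ⟨_, he, hx.imp (fun h => mem_termVars_func.2 ⟨i, h⟩)
        fun h => mem_termVars_func.2 ⟨i, h⟩⟩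
  · have hf : (Equation.term (.func f s) (.func f t)).Unifies θ ↔
        ∀ i, (Equation.term (s i) (t i)).Unifies θ := by
      simp [Equation.Unifies, FirstOrder.Language.Term.subst, funext_iff]
    constructor
    · rintro hθ e (he' | ⟨i, rfl⟩)
      · exact hθ e he'.1
      · exact hf.1 (hθ _ he) i
    · intro hθ e he'
      by_cases hee : e = .term (.func f s) (.func f t)
      · rw [hee]
        exact hf.2 fun i => hθ _ (.inr ⟨i, rfl⟩)
      · exact hθ e (.inl ⟨he', hee⟩)

theorem UnifiesTidily.of_decomposeAtom {M : Moding L} {K : Query L V}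
    {n : ℕ} {p : L.Relations n} {s t : Fin n → L.Term V}
    (h : UnifiesTidily M (Set.range fun i => .term (s i) (t i)) K) :
    UnifiesTidily M {.atom ⟨n, p, s⟩ ⟨n, p, t⟩} K := by
  refine h.of_step (fun S hS => ?_) ?_ fun θ => ?_
  · have := MMAStep.decomposeAtom (S ∪ {.atom ⟨n, p, s⟩ ⟨n, p, t⟩}) n p s t (.inr rfl)
    rwa [hS.sdiff_union subset_rfl, Set.sdiff_self, Set.union_empty] at this
  · rintro x ⟨e, ⟨i, rfl⟩, hx⟩
    exact ⟨_, rfl, hx.imp (fun h => ⟨i, h⟩) fun h => ⟨i, h⟩⟩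
  · simp [Equation.Unifies, Atom.subst, funext_iff]

theorem UnifiesTidily.of_orient {M : Moding L} {U : Set (Equation L V)} {K : Query L V}
    {X : V} {t : L.Term V} (ht : ¬ IsVar t) (he : .term t (.var X) ∈ U)
    (h : UnifiesTidily M ((U \ {.term t (.var X)}) ∪ {.term (.var X) t}) K) :
    UnifiesTidily M U K := by
  refine h.of_step (fun S hS => ?_) ?_ fun θ => ?_
  · rw [← Set.union_assoc, ← hS.sdiff_union (Set.singleton_subset_iff.2 he)]
    exact .orient _ t X (.inr he) ht
  · rintro x ⟨e, (he' | rfl), hx⟩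
    · exact ⟨e, he'.1, hx⟩
    · exact ⟨_, he, hx.symm⟩
  · constructor
    · rintro hθ e (he' | rfl)
      · exact hθ e he'.1
      · exact (hθ _ he).symm
    · intro hθ e he'
      by_cases hee : e = .term t (.var X)
      · rw [hee]
        exact (hθ _ (.inr rfl)).symm
      · exact hθ e (.inl ⟨he', hee⟩)

theorem Solved.eliminate {S U : Set (Equation L V)} (hS : Solved S U) {X : V} {t : L.Term V}
    (hX : X ∉ termVars t) (he : .term (.var X) t ∈ U) :
    Solved (Equation.subst (single X t) '' S ∪ {.term (.var X) t})
      (Equation.subst (single X t) '' (U \ {.term (.var X) t})) := by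
  have hXe : ∀ e : Equation L V, X ∉ (e.subst (single X t)).vars := fun e h =>
    (mem_equation_vars_subst_single hX h).1 rfl
  have hXs : X ∈ termVars (L := L) (.var X) := by simp [mem_termVars]
  rintro e (⟨e, heS, rfl⟩ | rfl)
  · obtain ⟨Y, r, rfl, h1, h2, h3⟩ := hS e heS
    have hY := h2 _ he
    simp only [Equation.vars, Set.mem_union, not_or] at hY
    have hYX : Y ≠ X := fun h => hY.1 (h ▸ hXs)
    refine ⟨Y, r.subst (single X t), ?_, fun h => ?_, ?_, ?_⟩
    · simp [Equation.subst, FirstOrder.Language.Term.subst, single_of_ne t hYX]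
    · rcases (mem_termVars_subst_single hX h).2 with h | h
      · exact h1 h
      · exact hY.2 h.1
    · rintro _ ⟨e, he', rfl⟩ h
      rcases (mem_equation_vars_subst_single hX h).2 with h | h
      · exact h2 e he'.1 h
      · exact hY.2 h
    · rintro _ (⟨e, he', rfl⟩ | rfl) hne h
      · rcases (mem_equation_vars_subst_single hX h).2 with h | h
        · exact h3 e he' (fun h => hne (by rw [h])) h
        · exact hY.2 h
      · exact h2 _ he h
  · refine ⟨X, t, rfl, hX, ?_, ?_⟩
    · rintro _ ⟨e, -, rfl⟩
      exact hXe e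
    · rintro _ (⟨e, -, rfl⟩ | rfl) hne
      · exact hXe e
      · exact absurd rfl hne

/-- The equation for `X` moves to the solved part, and `X` disappears from the rest. A most general
unifier of the old system binds `X`, hence need not be most general for the new one. It is so on the
variables that still occur, which is why `UnifiesTidily` demands the factorization only there. -/
theorem UnifiesTidily.of_eliminate {M : Moding L} {U : Set (Equation L V)} {K : Query L V}
    {X : V} {t : L.Term V} (hX : X ∉ termVars t) (he : .term (.var X) t ∈ U)
    (h : UnifiesTidily M (Equation.subst (single X t) '' (U \ {.term (.var X) t}))
      (querySubst K (single X t))) :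
    UnifiesTidily M U K := by
  refine ⟨fun S hS => ?_, fun θ hθ hmgu => ?_⟩
  · have h1 := h.1 _ (hS.eliminate hX he)
    have heq : Equation.subst (single X t) '' S ∪ {.term (.var X) t} ∪
          Equation.subst (single X t) '' (U \ {.term (.var X) t}) =
        Equation.subst (single X t) '' ((S ∪ U) \ {.term (.var X) t}) ∪ {.term (.var X) t} := by
      rw [hS.sdiff_union (Set.singleton_subset_iff.2 he), Set.image_union, Set.union_right_comm]
    rw [heq] at h1
    by_cases hocc : ∃ e ∈ (S ∪ U) \ {.term (.var X) t}, X ∈ e.vars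
    · exact .of_step (.eliminate _ X t (.inr he) hX hocc) h1
    -- If `X` occurs nowhere else the action is not applicable, but then the substitution changes
    -- nothing and the two sets of equations coincide.
    · push Not at hocc
      have himg : Equation.subst (single X t) '' ((S ∪ U) \ {.term (.var X) t}) =
          (S ∪ U) \ {.term (.var X) t} := by
        refine (Set.image_congr fun e he' => ?_).trans (Set.image_id _)
        exact equation_subst_single_eq_self (hocc e he')
      rwa [himg, Set.sdiff_union_of_subset (Set.singleton_subset_iff.2 (.inr he))] at h1
  · have hsplit : ∀ σ : V → L.Term V, (Equation.term (.var X) t).Unifies σ →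
        (fun x => (single X t x).subst σ) = σ := by
      intro σ hσ
      funext x
      by_cases hxX : x = X
      · subst hxX
        rw [single_same]
        exact hσ.symm
      · rw [single_of_ne t hxX]
        rfl
    have hθX := hsplit θ.map (hθ _ he)
    have h2 := h.2 θ
    rw [querySubst_querySubst, hθX] at h2
    refine h2 ?_ fun τ hτ => ?_
    · rintro _ ⟨e, he', rfl⟩
      rw [Equation.unifies_subst, hθX]
      exact hθ e he'.1
    -- A unifier `τ` of the reduced system extends to the old one as `{X/t}τ`, which agrees with `τ`
    -- away from `X`.
    · have hτX : ∀ e ∈ U, e.Unifies (Subst.singleComp X t τ).map := by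
        intro e he'
        by_cases hee : e = .term (.var X) t
        · rw [hee]
          change (Equation.term (.var X) t).Unifies fun x => (single X t x).subst τ.map
          rw [← Equation.unifies_subst]
          simp [Equation.subst, Equation.Unifies, FirstOrder.Language.Term.subst,
            subst_single_eq_self hX]
        · exact Equation.unifies_subst.1 (hτ _ ⟨e, ⟨he', hee⟩, rfl⟩)
      obtain ⟨η, hη⟩ := hmgu _ hτX
      refine ⟨η, fun x hx => ?_⟩
      have hx' : x ≠ X ∧ x ∈ equationVars U ∪ queryVars K := by
        rcases hx with ⟨_, ⟨e, he', rfl⟩, hx⟩ | hx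
        · obtain ⟨h1, h2 | h2⟩ := mem_equation_vars_subst_single hX hx
          · exact ⟨h1, .inl ⟨e, he'.1, h2⟩⟩
          · exact ⟨h1, .inl ⟨_, he, .inr h2⟩⟩
        · obtain ⟨y, hy, hx⟩ := mem_queryVars_querySubst.1 hx
          by_cases hyX : y = X
          · rw [hyX, single_same] at hx
            exact ⟨fun h => hX (h ▸ hx), .inl ⟨_, he, .inr hx⟩⟩
          · rw [single_of_ne t hyX, mem_termVars, termOccs_var, List.mem_singleton] at hx
            subst hx
            exact ⟨hyX, .inr hy⟩
      rw [hη x hx'.2]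
      simp only [Subst.singleComp, single_of_ne t hx'.1, FirstOrder.Language.Term.subst]

/-- Both orientations have to be removed: the reoriented equation may coincide with one already in
the set. -/
theorem UnifiesTidily.of_orient_eliminate {M : Moding L} {U : Set (Equation L V)} {K : Query L V}
    {X : V} {t : L.Term V} (ht : ¬ IsVar t) (hX : X ∉ termVars t) (he : .term t (.var X) ∈ U)
    (h : UnifiesTidily M
      (Equation.subst (single X t) '' (U \ {.term t (.var X), .term (.var X) t}))
      (querySubst K (single X t))) :
    UnifiesTidily M U K := by
  refine .of_orient ht he (.of_eliminate hX (.inr rfl) ?_)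
  convert h using 2
  ext e
  simp only [Set.mem_sdiff, Set.mem_union, Set.mem_singleton_iff, Set.mem_insert_iff]
  tauto

/-! ### Oriented equations -/

variable (L V) in
/-- An equation between terms, one side of which is considered as output and the other one as
input. The flag tells whether the input is the left hand side. -/
structure OrientedEq where
  out : L.Term V
  inn : L.Term V
  flip : Bool

namespace OrientedEq

/-- The underlying equation. -/
def eqn : OrientedEq L V → Equation L V
  | ⟨s, t, false⟩ => .term s t
  | ⟨s, t, true⟩ => .term t s

def node (u : OrientedEq L V) : List V × List V := (termOccs u.out, termOccs u.inn)

def occs (u : OrientedEq L V) : List V := termOccs u.out ++ termOccs u.inn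

def subst (f : V → L.Term V) (u : OrientedEq L V) : OrientedEq L V :=
  ⟨u.out.subst f, u.inn.subst f, u.flip⟩

theorem mem_occs {u : OrientedEq L V} {x : V} : x ∈ u.occs ↔ x ∈ u.eqn.vars := by
  obtain ⟨s, t, _ | _⟩ := u
  · simp [occs, eqn, Equation.vars, mem_termVars]
  · simp [occs, eqn, Equation.vars, mem_termVars, or_comm]

theorem eqn_subst (f : V → L.Term V) (u : OrientedEq L V) :
    (u.subst f).eqn = u.eqn.subst f := by
  obtain ⟨s, t, _ | _⟩ := u <;> rfl

theorem node_subst (f : V → L.Term V) (u : OrientedEq L V) :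
    (u.subst f).node = nodeBind (fun x => termOccs (f x)) u.node := by
  simp [node, subst, nodeBind, termOccs_subst]

theorem mem_occs_subst {f : V → L.Term V} {u : OrientedEq L V} {y : V} :
    y ∈ (u.subst f).occs ↔ ∃ x ∈ u.occs, y ∈ termVars (f x) := by
  rw [mem_occs, eqn_subst, mem_equation_vars_subst]
  simp [mem_occs]

end OrientedEq

/-- The set of equations underlying a list of oriented equations. -/
def equations (U : List (OrientedEq L V)) : Set (Equation L V) := {e | ∃ u ∈ U, u.eqn = e}

theorem equations_append (U U' : List (OrientedEq L V)) :
    equations (U ++ U') = equations U ∪ equations U' := by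
  ext e
  simp [equations, or_and_right, exists_or]

theorem image_subst_equations (f : V → L.Term V) (U : List (OrientedEq L V)) :
    Equation.subst f '' equations U = equations (U.map (OrientedEq.subst f)) := by
  ext e
  simp [equations, OrientedEq.eqn_subst]

/-- The algorithm acts on sets, whereas linearity counts occurrences in lists. An equation may be
listed repeatedly or with both orientations, so an action on it deletes all copies. The rest is a
sublist, hence still tidy. -/
theorem exists_filter_equations (u : OrientedEq L V) (U : List (OrientedEq L V))
    {R : Set (Equation L V)} (hu : u.eqn ∈ R) :
    ∃ p : OrientedEq L V → Bool, (∀ w, p w = false → w.eqn ∈ R) ∧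
      equations (u :: U) \ R = equations (U.filter p) := by
  classical
  refine ⟨fun w => decide (w.eqn ∉ R), fun w hw => by simpa using hw, ?_⟩
  ext e
  constructor
  · rintro ⟨⟨w, hw, rfl⟩, hR⟩
    rcases List.mem_cons.1 hw with rfl | hw
    · exact absurd hu hR
    · exact ⟨w, List.mem_filter.2 ⟨hw, by simpa using hR⟩, rfl⟩
  · rintro ⟨w, hw, rfl⟩
    obtain ⟨hw, hR⟩ := List.mem_filter.1 hw
    exact ⟨⟨w, List.mem_cons_of_mem _ hw, rfl⟩, by simpa using hR⟩

/-- The equation `e` binds `X` to `t`, possibly after a reorientation. -/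
def Binds (e : Equation L V) (X : V) (t : L.Term V) : Prop :=
  e = .term (.var X) t ∨ (e = .term t (.var X) ∧ ¬ IsVar t)

theorem UnifiesTidily.of_binds {M : Moding L} {K : Query L V} {u : OrientedEq L V}
    {U : List (OrientedEq L V)} {X : V} {t : L.Term V} (hu : Binds u.eqn X t)
    (hX : X ∉ termVars t)
    (h : ∀ p : OrientedEq L V → Bool,
      (∀ w, p w = false → w.eqn = .term (.var X) t ∨ w.eqn = .term t (.var X)) →
      UnifiesTidily M (equations ((U.filter p).map (.subst (single X t))))
        (querySubst K (single X t))) :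
    UnifiesTidily M (equations (u :: U)) K := by
  have hmem : u.eqn ∈ equations (u :: U) := ⟨u, List.mem_cons_self, rfl⟩
  rcases hu with hu | ⟨hu, ht⟩
  · obtain ⟨p, hp, hpU⟩ := exists_filter_equations u U (R := {.term (.var X) t}) hu
    refine .of_eliminate hX (hu ▸ hmem) ?_
    rw [hpU, image_subst_equations]
    exact h p fun w hw => .inl (hp w hw)
  · obtain ⟨p, hp, hpU⟩ := exists_filter_equations u U
      (R := {.term t (.var X), .term (.var X) t}) (.inl hu)
    refine .of_orient_eliminate ht hX (hu ▸ hmem) ?_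
    rw [hpU, image_subst_equations]
    exact h p fun w hw => (hp w hw).symm

/-- The equations between the arguments. -/
def argEqs {n : ℕ} (s t : Fin n → L.Term V) (b : Bool) : List (OrientedEq L V) :=
  List.ofFn fun i => ⟨s i, t i, b⟩

theorem equations_argEqs {n : ℕ} (s t : Fin n → L.Term V) (b : Bool) :
    equations (argEqs s t b) = Set.range fun i => OrientedEq.eqn ⟨s i, t i, b⟩ := by
  ext e
  constructor
  · rintro ⟨u, hu, rfl⟩
    obtain ⟨i, rfl⟩ := List.mem_ofFn.1 hu
    exact ⟨i, rfl⟩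
  · rintro ⟨i, rfl⟩
    exact ⟨_, List.mem_ofFn.2 ⟨i, rfl⟩, rfl⟩

/-- Merges clash and decomposition: only equal function symbols leave something to prove. -/
theorem UnifiesTidily.of_func {M : Moding L} {K : Query L V} {m n : ℕ} {f : L.Functions m}
    {g : L.Functions n} {s : Fin m → L.Term V} {t : Fin n → L.Term V} {b : Bool}
    {U : List (OrientedEq L V)}
    (h : ∀ (t' : Fin m → L.Term V) (p : OrientedEq L V → Bool),
      (FirstOrder.Language.Term.func g t : L.Term V) = .func f t' →
      (∀ w, p w = false → w.eqn = OrientedEq.eqn ⟨.func f s, .func f t', b⟩) →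
      UnifiesTidily M (equations (argEqs s t' b ++ U.filter p)) K) :
    UnifiesTidily M (equations (⟨.func f s, .func g t, b⟩ :: U)) K := by
  have hmem : OrientedEq.eqn ⟨.func f s, .func g t, b⟩ ∈
      equations (⟨.func f s, .func g t, b⟩ :: U) := ⟨_, List.mem_cons_self, rfl⟩
  by_cases hfg : (⟨m, f⟩ : Σ k, L.Functions k) = ⟨n, g⟩
  · cases hfg
    obtain ⟨p, hp, hpU⟩ := exists_filter_equations ⟨.func f s, .func f t, b⟩ U
      (R := {OrientedEq.eqn ⟨.func f s, .func f t, b⟩}) rfl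
    have h1 := h t p rfl hp
    rw [equations_append, ← hpU, Set.union_comm] at h1
    cases b
    · refine .of_decomposeTerm hmem ?_
      rwa [equations_argEqs] at h1
    · refine .of_decomposeTerm hmem ?_
      rwa [equations_argEqs] at h1
  · cases b
    · exact .of_clash hfg hmem
    · exact .of_clash (Ne.symm hfg) hmem

/-! ### Termination measures -/

/-- The number of symbols of a term. -/
def termSize : L.Term V → ℕ
  | .var _ => 1
  | .func _ ts => (List.ofFn fun i => termSize (ts i)).sum + 1

def outSize (U : List (OrientedEq L V)) : ℕ := (U.map fun u => termSize u.out).sum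

open Classical in
/-- The variables of a list of oriented equations. -/
noncomputable def orientedVars (U : List (OrientedEq L V)) : Finset V :=
  (U.flatMap OrientedEq.occs).toFinset

theorem mem_orientedVars {U : List (OrientedEq L V)} {x : V} :
    x ∈ orientedVars U ↔ ∃ u ∈ U, x ∈ u.occs := by
  simp [orientedVars]

theorem outSize_argEqs_lt {n : ℕ} {f : L.Functions n} {s t : Fin n → L.Term V} {w : L.Term V}
    {b : Bool} {U : List (OrientedEq L V)} {p : OrientedEq L V → Bool} :
    outSize (argEqs s t b ++ U.filter p) < outSize (⟨.func f s, w, b⟩ :: U) := by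
  have h1 : outSize (U.filter p) ≤ outSize U :=
    (List.filter_sublist.map _).sum_le_sum fun _ _ => Nat.zero_le _
  have h2 : outSize (argEqs s t b) + 1 = termSize (.func f s) := by
    rw [outSize, argEqs, List.map_ofFn, termSize]
    rfl
  simp only [outSize, List.map_append, List.sum_append, List.map_cons, List.sum_cons] at *
  omega

theorem mem_occs_func {n : ℕ} {f g : L.Functions n} {s t : Fin n → L.Term V} {b : Bool} {x : V} :
    x ∈ OrientedEq.occs ⟨.func f s, .func g t, b⟩ ↔ ∃ u ∈ argEqs s t b, x ∈ u.occs := by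
  simp only [OrientedEq.occs, List.mem_append, ← mem_termVars, mem_termVars_func, argEqs,
    List.mem_ofFn]
  simp [exists_or]

theorem orientedVars_argEqs_subset {n : ℕ} {f g : L.Functions n} {s t : Fin n → L.Term V}
    {b : Bool} {U : List (OrientedEq L V)} {p : OrientedEq L V → Bool} :
    orientedVars (argEqs s t b ++ U.filter p) ⊆
      orientedVars (⟨.func f s, .func g t, b⟩ :: U) := by
  intro x hx
  obtain ⟨u, hu, hxu⟩ := mem_orientedVars.1 hx
  rcases List.mem_append.1 hu with hu | hu
  · exact mem_orientedVars.2 ⟨_, List.mem_cons_self, mem_occs_func.2 ⟨u, hu, hxu⟩⟩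
  · exact mem_orientedVars.2 ⟨u, List.mem_cons_of_mem _ (List.mem_of_mem_filter hu), hxu⟩

theorem card_orientedVars_lt {U : List (OrientedEq L V)} {u : OrientedEq L V} {X : V}
    {t : L.Term V} {p : OrientedEq L V → Bool} (hX : X ∉ termVars t) (hXu : X ∈ u.occs)
    (htu : ∀ x ∈ termVars t, x ∈ u.occs) :
    (orientedVars ((U.filter p).map (.subst (single X t)))).card <
      (orientedVars (u :: U)).card := by
  refine Finset.card_lt_card ((Finset.ssubset_iff_of_subset ?_).2
    ⟨X, mem_orientedVars.2 ⟨u, List.mem_cons_self, hXu⟩, ?_⟩)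
  · intro x hx
    obtain ⟨_, hw', hxw⟩ := mem_orientedVars.1 hx
    obtain ⟨w, hw, rfl⟩ := List.mem_map.1 hw'
    rw [OrientedEq.mem_occs, OrientedEq.eqn_subst] at hxw
    rcases (mem_equation_vars_subst_single hX hxw).2 with h | h
    · exact mem_orientedVars.2 ⟨w, List.mem_cons_of_mem _ (List.mem_of_mem_filter hw),
        OrientedEq.mem_occs.2 h⟩
    · exact mem_orientedVars.2 ⟨u, List.mem_cons_self, htu x h⟩
  · intro hx
    obtain ⟨_, hw', hxw⟩ := mem_orientedVars.1 hx
    obtain ⟨w, hw, rfl⟩ := List.mem_map.1 hw'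
    rw [OrientedEq.mem_occs, OrientedEq.eqn_subst] at hxw
    exact (mem_equation_vars_subst_single hX hxw).1 rfl

/-! ### Unification of tidy systems -/

theorem map_node_append_subst (M : Moding L) (U : List (OrientedEq L V)) (K : Query L V)
    (f : V → L.Term V) :
    (U.map (.subst f)).map OrientedEq.node ++ (querySubst K f).map (Atom.node M) =
      (U.map OrientedEq.node ++ K.map (Atom.node M)).map
        (nodeBind fun x => termOccs (f x)) := by
  simp [map_node_querySubst, OrientedEq.node_subst]

theorem map_node_argEqs {n : ℕ} (s t : Fin n → L.Term V) (b : Bool) :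
    (argEqs s t b).map OrientedEq.node =
      List.ofFn fun i => (termOccs (s i), termOccs (t i)) := by
  rw [argEqs, List.map_ofFn]
  rfl

/-- Lexicographic induction: elimination lowers the number of variables, decomposition keeps it from
growing and lowers the size of the output sides. -/
theorem unifiesTidily_of_tidyNodes (M : Moding L) (n m : ℕ) (U : List (OrientedEq L V))
    (K : Query L V) (hn : (orientedVars U).card ≤ n) (hm : outSize U < m)
    (hU : TidyNodes (U.map OrientedEq.node ++ K.map (Atom.node M))) :
    UnifiesTidily M (equations U) K := by
  induction n using Nat.strong_induction_on generalizing m U K with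
  | _ n ihn =>
  induction m generalizing U K with
  | zero => omega
  | succ m ihm =>
  cases U with
  | nil =>
    have : equations ([] : List (OrientedEq L V)) = ∅ := by simp [equations]
    rw [this]
    exact unifiesTidily_empty hU
  | cons u U =>
  have elim : ∀ (X : V) (t : L.Term V), Binds u.eqn X t → X ∉ termVars t →
      TidyNodes ((U.map OrientedEq.node ++ K.map (Atom.node M)).map
        (nodeBind fun x => termOccs (single X t x))) →
      UnifiesTidily M (equations (u :: U)) K := by
    intro X t hu hX hT
    refine .of_binds hu hX fun p _ => ?_
    have hvars : X ∈ u.occs ∧ ∀ x ∈ termVars t, x ∈ u.occs := by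
      simp only [OrientedEq.mem_occs]
      rcases hu with hu | ⟨hu, -⟩ <;> rw [hu] <;> simp +contextual [Equation.vars, mem_termVars]
    refine ihn _ ((card_orientedVars_lt hX hvars.1 hvars.2).trans_le hn) _ _ _ le_rfl
      (Nat.lt_succ_self _) ?_
    rw [map_node_append_subst]
    exact hT.of_sublist (((List.filter_sublist.map _).append (List.Sublist.refl _)).map _)
  -- This is where the occur-check is excluded: a common variable would have a rank below itself.
  have irrefl : ∀ x ∈ termVars u.inn, x ∉ termVars u.out := by
    obtain ⟨-, r, hr⟩ := hU
    intro x hx hx'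
    exact lt_irrefl _ (hr u.node (by simp) x hx x hx')
  have elim_out : ∀ X : V, u.out = .var X → Binds u.eqn X u.inn →
      UnifiesTidily M (equations (u :: U)) K := by
    intro X hX hb
    have hU' : TidyNodes (([X], termOccs u.inn) ::
        (U.map OrientedEq.node ++ K.map (Atom.node M))) := by
      simpa [OrientedEq.node, hX] using hU
    refine elim X u.inn hb (fun h => irrefl X h (by simp [hX, mem_termVars])) ?_
    exact hU'.eliminate_out (by simp) fun x hx => by simp [single_of_ne _ hx]
  have elim_in : ∀ X : V, u.inn = .var X → Binds u.eqn X u.out →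
      UnifiesTidily M (equations (u :: U)) K := by
    intro X hX hb
    have hU' : TidyNodes ((termOccs u.out, [X]) ::
        (U.map OrientedEq.node ++ K.map (Atom.node M))) := by
      simpa [OrientedEq.node, hX] using hU
    refine elim X u.out hb (irrefl X (by simp [hX, mem_termVars])) ?_
    exact hU'.eliminate_in (by simp) fun x hx => by simp [single_of_ne _ hx]
  obtain ⟨s, t, b⟩ := u
  cases s with
  | var X =>
    cases b with
    | false => exact elim_out X rfl (.inl rfl)
    | true =>
      -- The equation reads `t ≐ X`. If `t` is a variable, reorientation is not allowed, so the
      -- input variable on the left is eliminated instead.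
      by_cases ht : IsVar t
      · obtain ⟨Y, rfl⟩ := ht
        exact elim_in Y rfl (.inl rfl)
      · exact elim_out X rfl (.inr ⟨rfl, ht⟩)
  | func f s =>
    cases t with
    | var X =>
      cases b with
      | false => exact elim_in X rfl (.inr ⟨rfl, fun ⟨Y, hY⟩ => nomatch hY⟩)
      | true => exact elim_in X rfl (.inl rfl)
    | func g t =>
      refine .of_func fun t' p ht' _ => ?_
      rw [ht'] at hU hn hm
      refine ihm _ _ ((Finset.card_le_card orientedVars_argEqs_subset).trans hn)
        (outSize_argEqs_lt.trans_le (Nat.lt_succ_iff.1 hm)) ?_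
      rw [List.map_append, map_node_argEqs, List.append_assoc]
      refine TidyNodes.of_sublist (TidyNodes.decompose (o := fun i => termOccs (s i))
        (i := fun i => termOccs (t' i)) (N := U.map OrientedEq.node ++ K.map (Atom.node M)) ?_) ?_
      · simpa [OrientedEq.node] using hU
      · exact (List.Sublist.refl _).append
          ((List.filter_sublist.map _).append (List.Sublist.refl _))

open Classical in
/-- Erase the variables of `W`. -/
noncomputable def eraseVars (W : Set V) (x : V) : List V := if x ∈ W then [] else [x]

theorem eraseVars_sublist (W : Set V) (x : V) : (eraseVars W x).Sublist [x] := by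
  unfold eraseVars
  split_ifs <;> simp

/-- Solving `U₁` binds each of its variables to a ground term, so the variables of `W` may be
ignored in the tidiness of the rest. Neither linearity nor a rank is needed for `U₁`: ground
right-hand sides cannot cause an occur-check. -/
theorem unifiesTidily_of_ground (M : Moding L) (n m : ℕ) (U₁ U₂ : List (OrientedEq L V))
    (K : Query L V) (W : Set V) (hn : (orientedVars U₁).card ≤ n) (hm : outSize U₁ < m)
    (hg : ∀ u ∈ U₁, IsGround u.inn) (hW : ∀ x ∈ W, x ∈ orientedVars U₁)
    (hU : TidyNodes ((U₂.map OrientedEq.node ++ K.map (Atom.node M)).map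
      (nodeBind (eraseVars W)))) :
    UnifiesTidily M (equations (U₁ ++ U₂)) K := by
  induction n using Nat.strong_induction_on generalizing m U₁ U₂ K W with
  | _ n ihn =>
  induction m generalizing U₁ U₂ K W with
  | zero => omega
  | succ m ihm =>
  cases U₁ with
  | nil =>
    refine unifiesTidily_of_tidyNodes M _ _ U₂ K le_rfl (Nat.lt_succ_self _) ?_
    -- With `U₁` exhausted `W` is empty, and nothing is erased any more.
    have hW' : eraseVars W = fun x => [x] := by
      funext x
      exact if_neg fun hx => by simpa [mem_orientedVars] using hW x hx
    rw [hW'] at hU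
    convert hU using 1
    refine (List.map_id _).symm.trans (List.map_congr_left fun k _ => ?_)
    simp [nodeBind]
  | cons u U₁ =>
  have hug : IsGround u.inn := hg u List.mem_cons_self
  have elim : ∀ X : V, u.out = .var X → Binds u.eqn X u.inn →
      UnifiesTidily M (equations (u :: U₁ ++ U₂)) K := by
    intro X huX hb
    have hX : X ∉ termVars u.inn := by rw [hug]; simp
    rw [List.cons_append]
    refine .of_binds hb hX fun p hp => ?_
    -- The deleted copies contain no variable but `X`, so every other variable of `W` still occurs
    -- in the remaining ground equations.
    have hxu : ∀ w : OrientedEq L V, (w.eqn = .term (.var X) u.inn ∨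
        w.eqn = .term u.inn (.var X)) → ∀ x ∈ w.occs, x = X := by
      intro w hw x hx
      rw [OrientedEq.mem_occs] at hx
      rcases hw with hw | hw <;> rw [hw, Equation.vars, hug] at hx <;>
        simpa [mem_termVars] using hx
    rw [List.filter_append, List.map_append]
    have hXu : X ∈ u.occs := by simp [OrientedEq.occs, huX]
    have hcard : (orientedVars ((U₁.filter p).map (.subst (single X u.inn)))).card < n :=
      (card_orientedVars_lt hX hXu fun _ hx => List.mem_append_right _ hx).trans_le hn
    refine ihn _ hcard _ _ _ _ (W \ {X}) le_rfl (Nat.lt_succ_self _) ?_ ?_ ?_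
    · intro _ hw₀
      obtain ⟨w, hw, rfl⟩ := List.mem_map.1 hw₀
      have hw' := hg w (List.mem_cons_of_mem _ (List.mem_of_mem_filter hw))
      rw [isGround_iff] at hw' ⊢
      simp [OrientedEq.subst, termOccs_subst, hw']
    · rintro x ⟨hxW, hxX⟩
      obtain ⟨w, hw, hxw⟩ := mem_orientedVars.1 (hW x hxW)
      rw [List.mem_cons] at hw
      rcases hw with rfl | hw
      · exact absurd (hxu w (hb.imp id And.left) x hxw) hxX
      · have hpw : p w = true := by
          by_contra hpw
          exact hxX (hxu w (hp w (by simpa using hpw)) x hxw)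
        refine mem_orientedVars.2 ⟨_, List.mem_map.2 ⟨w, List.mem_filter.2 ⟨hw, hpw⟩, rfl⟩, ?_⟩
        refine OrientedEq.mem_occs_subst.2 ⟨x, hxw, ?_⟩
        rw [single_of_ne _ hxX]
        simp [mem_termVars]
    · rw [map_node_append_subst, List.map_map]
      -- Substituting a ground term for `X` and then erasing `W \ {X}` amounts to erasing `W` and
      -- then `X`. This covers the case `X ∉ W` too.
      have h1 := (hU.erase (eraseVars_sublist {X})).of_sublist
        ((((List.filter_sublist (p := p)).map _).append (List.Sublist.refl _)).map _ |>.map _)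
      rw [List.map_map] at h1
      convert h1 using 2
      funext k
      simp only [Function.comp_apply, nodeBind_nodeBind]
      congr 1
      funext x
      by_cases hx : x = X
      · subst hx
        rw [single_same, isGround_iff.1 hug]
        unfold eraseVars
        split_ifs <;> simp
      · rw [single_of_ne _ hx]
        unfold eraseVars
        by_cases hxW : x ∈ W <;> simp [hx, hxW]
  obtain ⟨s, t, b⟩ := u
  have ht : ¬ IsVar t := by
    rintro ⟨Y, rfl⟩
    simp [isGround_iff] at hug
  cases s with
  | var X =>
    cases b with
    | false => exact elim X rfl (.inl rfl)
    | true => exact elim X rfl (.inr ⟨rfl, ht⟩)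
  | func f s =>
    cases t with
    | var X => exact absurd ⟨X, rfl⟩ ht
    | func g t =>
      rw [List.cons_append]
      refine .of_func fun t' p ht' hp => ?_
      rw [ht'] at hn hm hg hW
      rw [List.filter_append, ← List.append_assoc]
      refine ihm _ _ _ W ((Finset.card_le_card orientedVars_argEqs_subset).trans hn)
        (outSize_argEqs_lt.trans_le (Nat.lt_succ_iff.1 hm)) ?_ ?_ ?_
      · intro w hw
        rcases List.mem_append.1 hw with hw | hw
        · obtain ⟨i, rfl⟩ := List.mem_ofFn.1 hw
          have h1 := hg _ List.mem_cons_self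
          refine Set.eq_empty_iff_forall_notMem.2 fun x hx => ?_
          exact Set.eq_empty_iff_forall_notMem.1 h1 x (mem_termVars_func.2 ⟨i, hx⟩)
        · exact hg w (List.mem_cons_of_mem _ (List.mem_of_mem_filter hw))
      · intro x hx
        obtain ⟨w, hw, hxw⟩ := mem_orientedVars.1 (hW x hx)
        rw [mem_orientedVars]
        have key : x ∈ OrientedEq.occs ⟨.func f s, .func f t', b⟩ →
            ∃ u ∈ argEqs s t' b ++ U₁.filter p, x ∈ u.occs := fun h => by
          obtain ⟨u, hu, hxu⟩ := mem_occs_func.1 h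
          exact ⟨u, List.mem_append_left _ hu, hxu⟩
        rcases List.mem_cons.1 hw with rfl | hw
        · exact key hxw
        · by_cases hpw : p w = true
          · exact ⟨w, List.mem_append_right _ (List.mem_filter.2 ⟨hw, hpw⟩), hxw⟩
          · rw [OrientedEq.mem_occs, hp w (by simpa using hpw), ← OrientedEq.mem_occs] at hxw
            exact key hxw
      · exact hU.of_sublist (((List.filter_sublist.map _).append (List.Sublist.refl _)).map _)

/-! ### Weakly tidy clauses -/

/-- The clause is tidy, apart from occurrences of the variables that occur in the `+` positions
(under `M`) of its head. -/
def TidyModInputs (M : ThreeModing L) (M' : Moding L) (C : Clause L V) : Prop :=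
  TidyNodes ((C.body.map (Atom.node M')).map (nodeBind (eraseVars (varIn3 M C.head)))) ∧
    ((C.head.node M').2.flatMap (eraseVars (varIn3 M C.head)) ++
      ((C.body.map (Atom.node M')).map (nodeBind (eraseVars (varIn3 M C.head)))).flatMap
        Prod.fst).Nodup

/-- Tidiness sees only occurrences of variables, and a ground term has none, so grounding acts as
erasing. Linearity of the head inputs, linearity of the body outputs and their disjointness combine
into one linear list. -/
theorem tidyModInputs_of_tidyClause {M : ThreeModing L} {M' : Moding L} {C : Clause L V}
    {θ : Subst L V} (hθ : GroundsHeadInputs M C θ) (hC : TidyClause M' (C.subst θ.map)) :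
    TidyModInputs M M' C := by
  have herase : (fun x => termOccs (θ.map x)) = eraseVars (varIn3 M C.head) := by
    funext x
    unfold eraseVars
    split_ifs with hx
    · exact isGround_iff.1 (hθ.1 x hx)
    · rw [hθ.2 x hx, termOccs_var]
  obtain ⟨h1, h2, h3⟩ := hC
  have hbody : (C.subst θ.map).body.map (Atom.node M') =
      (C.body.map (Atom.node M')).map (nodeBind (eraseVars (varIn3 M C.head))) := by
    rw [← herase]
    exact map_node_querySubst M' C.body θ.map
  have hhead : ((C.subst θ.map).head.node M').2 =
      (C.head.node M').2.flatMap (eraseVars (varIn3 M C.head)) := by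
    rw [← herase]
    exact congrArg Prod.snd (C.head.node_subst M' θ.map)
  rw [tidyQuery_iff] at h1
  rw [TidyModInputs, ← hbody, ← hhead]
  refine ⟨h1, List.nodup_append'.2 ⟨h2, h1.1, fun x hx hx' => ?_⟩⟩
  obtain ⟨n, hn, hxn⟩ := List.mem_flatMap.1 hx'
  obtain ⟨B, hB, rfl⟩ := List.mem_map.1 hn
  exact h3 x (mem_varIn.2 hx) B hB (mem_varOut.2 hxn)

theorem mem_varIn3_subst {M : ThreeModing L} {A : Atom L V} {f : V → L.Term V} {y : V} :
    y ∈ varIn3 M (A.subst f) ↔ ∃ x ∈ varIn3 M A, y ∈ termVars (f x) := by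
  have h : inTerms3 M (A.subst f) = (inTerms3 M A).map fun t => t.subst f := by
    simp only [inTerms3, List.map_map]
    rfl
  simp only [varIn3, h, List.mem_map, Set.mem_ofPred_eq]
  constructor
  · rintro ⟨_, ⟨t, ht, rfl⟩, hy⟩
    obtain ⟨x, hx, hy⟩ := mem_termVars_subst.1 hy
    exact ⟨x, ⟨t, ht, hx⟩, hy⟩
  · rintro ⟨x, ⟨t, ht, hx⟩, hy⟩
    exact ⟨_, ⟨t, ht, rfl⟩, mem_termVars_subst.2 ⟨x, hx, hy⟩⟩

theorem TidyModInputs.variant {M : ThreeModing L} {M' : Moding L} {C C' : Clause L V}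
    (hC : TidyModInputs M M' C) (h : IsVariant C' C) : TidyModInputs M M' C' := by
  obtain ⟨ρ, rfl⟩ := h
  have hvar : ∀ x, ρ x ∈ varIn3 M (C.subst fun x => .var (ρ x)).head ↔
      x ∈ varIn3 M C.head := by
    intro x
    rw [Clause.subst, mem_varIn3_subst]
    simp [mem_termVars]
  have herase : (fun x => (termOccs (L := L) (.var (ρ x))).flatMap
      (eraseVars (varIn3 M (C.subst fun x => .var (ρ x)).head))) =
      fun x => (eraseVars (varIn3 M C.head) x).flatMap fun x => [ρ x] := by
    funext x
    rw [termOccs_var, List.flatMap_singleton]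
    unfold eraseVars
    by_cases hx : x ∈ varIn3 M C.head
    · rw [if_pos hx, if_pos ((hvar x).2 hx)]
      rfl
    · rw [if_neg hx, if_neg fun h => hx ((hvar x).1 h)]
      rfl
  have hbody : ((C.subst fun x => .var (ρ x)).body.map (Atom.node M')).map
      (nodeBind (eraseVars (varIn3 M (C.subst fun x => .var (ρ x)).head))) =
      ((C.body.map (Atom.node M')).map (nodeBind (eraseVars (varIn3 M C.head)))).map
        (nodeBind fun x => [ρ x]) := by
    rw [Clause.subst, map_node_querySubst]
    simp only [List.map_map]
    refine List.map_congr_left fun A _ => ?_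
    simp only [Function.comp_apply, nodeBind_nodeBind]
    rw [← herase]
    rfl
  have hhead : ((C.subst fun x => .var (ρ x)).head.node M').2.flatMap
      (eraseVars (varIn3 M (C.subst fun x => .var (ρ x)).head)) =
      ((C.head.node M').2.flatMap (eraseVars (varIn3 M C.head))).flatMap fun x => [ρ x] := by
    rw [List.flatMap_assoc, ← herase, ← List.flatMap_assoc]
    congr 1
    exact congrArg Prod.snd (C.head.node_subst M' _)
  rw [TidyModInputs, hbody, hhead]
  refine ⟨hC.1.rename fun x _ y _ h => ρ.injective h, ?_⟩
  rw [flatMap_fst_map_nodeBind, ← List.flatMap_append, ← List.map_eq_flatMap]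
  exact hC.2.map ρ.injective

/-! ### Resolution steps -/

theorem mem_queryVars_of_mem_node (M : Moding L) (Q : Query L V) {n : List V × List V} {x : V}
    (hn : n ∈ Q.map (Atom.node M)) (hx : x ∈ n.1 ∨ x ∈ n.2) : x ∈ queryVars Q := by
  obtain ⟨A, hA, rfl⟩ := List.mem_map.1 hn
  exact ⟨A, hA, mem_vars_of_mem_node hx⟩

/-- The heart of the resolution step: `TidyNodes.replace` supplies the tidy list that
`unifiesTidily_of_ground` requires. -/
theorem unifiesTidily_atom {M : ThreeModing L} {M' : Moding L} {Q₁ Q₂ : Query L V}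
    {A : Atom L V} {C : Clause L V} (hQ : TidyQuery M' (Q₁ ++ A :: Q₂)) (hA : InputGround M A)
    (hC : TidyModInputs M M' C) (hdisj : Disjoint C.vars (queryVars (Q₁ ++ A :: Q₂)))
    (hsym : A.symbol = C.head.symbol) :
    UnifiesTidily M' {.atom A C.head} (Q₁ ++ C.body ++ Q₂) := by
  obtain ⟨n, p, a⟩ := A
  obtain ⟨⟨m, q, h⟩, B⟩ := C
  cases hsym
  let I := (List.finRange n).filter fun i => M' n p i = .input
  let O := (List.finRange n).filter fun i => M' n p i = .output
  let G := (List.finRange n).filter fun i => M n p i = .input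
  -- `U₁` holds the equations of the `+` positions under `M`, with a ground side from the selected
  -- atom. `U₂` holds all positions, oriented by `M'`. Thus the `+` positions are listed twice,
  -- which is harmless since only the underlying set matters.
  let U₁ : List (OrientedEq L V) := G.map fun i => ⟨h i, a i, true⟩
  let U₂ : List (OrientedEq L V) :=
    I.map (fun i => ⟨h i, a i, true⟩) ++ O.map fun i => ⟨a i, h i, false⟩
  let W := varIn3 M (⟨n, p, h⟩ : Atom L V)
  have hrange : (Set.range fun i => Equation.term (a i) (h i)) = equations (U₁ ++ U₂) := by
    ext e
    constructor
    · rintro ⟨i, rfl⟩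
      cases hi : M' n p i with
      | input =>
        refine ⟨⟨h i, a i, true⟩, ?_, rfl⟩
        simp only [U₁, U₂, I, List.mem_append, List.mem_map, List.mem_filter]
        exact .inr (.inl ⟨i, ⟨List.mem_finRange i, by simpa using hi⟩, rfl⟩)
      | output =>
        refine ⟨⟨a i, h i, false⟩, ?_, rfl⟩
        simp only [U₁, U₂, O, List.mem_append, List.mem_map, List.mem_filter]
        exact .inr (.inr ⟨i, ⟨List.mem_finRange i, by simpa using hi⟩, rfl⟩)
    · rintro ⟨u, hu, rfl⟩
      simp only [U₁, U₂, List.mem_append, List.mem_map] at hu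
      rcases hu with ⟨i, -, rfl⟩ | ⟨i, -, rfl⟩ | ⟨i, -, rfl⟩ <;> exact ⟨i, rfl⟩
  refine .of_decomposeAtom ?_
  rw [hrange]
  refine unifiesTidily_of_ground M' _ _ U₁ U₂ _ W le_rfl (Nat.lt_succ_self _) ?_ ?_ ?_
  · intro u hu
    obtain ⟨i, hi, rfl⟩ := List.mem_map.1 hu
    exact hA _ (List.mem_map.2 ⟨i, hi, rfl⟩)
  · rintro x ⟨t, ht, hx⟩
    obtain ⟨i, hi, rfl⟩ := List.mem_map.1 ht
    exact mem_orientedVars.2 ⟨_, List.mem_map.2 ⟨i, hi, rfl⟩, List.mem_append_left _ hx⟩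
  let H : Atom L V := ⟨n, p, h⟩
  let A : Atom L V := ⟨n, p, a⟩
  have hsub : ∀ l : List V, l.flatMap (eraseVars W) ⊆ l := fun l =>
    (flatMap_sublist_self (eraseVars_sublist W) l).subset
  -- All variables of the clause; standardizing apart makes them disjoint from the query.
  let c := (H.node M').1 ++ (H.node M').2 ++ (B.map (Atom.node M')).flatMap fun n => n.1 ++ n.2
  have hcvars : ∀ x ∈ c, x ∈ (⟨H, B⟩ : Clause L V).vars := by
    intro x hx
    simp only [c, List.mem_append, List.mem_flatMap] at hx
    rcases hx with hx | ⟨k, hk, hx⟩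
    · exact .inl (mem_vars_of_mem_node hx)
    · exact .inr (mem_queryVars_of_mem_node M' B hk hx)
  have hQ' := (tidyQuery_iff.1 hQ).erase (eraseVars_sublist W)
  rw [List.map_append, List.map_cons, List.map_append, List.map_cons] at hQ'
  have hmain := TidyNodes.replace (I := (U₂.map OrientedEq.node).map (nodeBind (eraseVars W)))
    (c := c) hQ' hC.1 hC.2 ?_ ?_ ?_ ?_ ?_
  · simpa only [List.map_append, List.append_assoc] using hmain
  · intro k hk x hx
    obtain ⟨k, hk', rfl⟩ := List.mem_map.1 hk
    refine List.mem_append_right _ (List.mem_flatMap.2 ⟨k, hk', List.mem_append.2 ?_⟩)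
    exact hx.imp (fun h => hsub _ h) fun h => hsub _ h
  · intro x hx
    exact List.mem_append_left _ (List.mem_append_right _ (hsub _ hx))
  · intro k hk x hx hxc
    have hk₀ : k ∈ ((Q₁ ++ A :: Q₂).map (Atom.node M')).map (nodeBind (eraseVars W)) := by
      rw [List.map_append, List.map_cons, List.map_append, List.map_cons]
      exact hk
    obtain ⟨k, hk', rfl⟩ := List.mem_map.1 hk₀
    refine Set.disjoint_left.1 hdisj (hcvars x hxc) (mem_queryVars_of_mem_node M' _ hk' ?_)
    exact hx.imp (fun h => hsub _ h) fun h => hsub _ h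
  · simp only [U₂, List.map_append, List.flatMap_append, List.map_map, List.flatMap_map,
      Atom.node, inTerms, outTerms, List.flatMap_assoc]
    rfl
  · intro k hk
    obtain ⟨k, hk', rfl⟩ := List.mem_map.1 hk
    obtain ⟨u, hu, rfl⟩ := List.mem_map.1 hk'
    have hmap : ∀ l l' : List V, l ⊆ l' →
        l.flatMap (eraseVars W) ⊆ l'.flatMap (eraseVars W) := by
      intro l l' hl x hx
      obtain ⟨y, hy, hx⟩ := List.mem_flatMap.1 hx
      exact List.mem_flatMap.2 ⟨y, hl hy, hx⟩
    have hin : ∀ b : Fin n → L.Term V, ∀ i ∈ I,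
        termOccs (b i) ⊆ (Atom.node M' ⟨n, p, b⟩).2 := fun b i hi x hx =>
      List.mem_flatMap.2 ⟨_, List.mem_map.2 ⟨i, hi, rfl⟩, hx⟩
    have hout : ∀ b : Fin n → L.Term V, ∀ i ∈ O,
        termOccs (b i) ⊆ (Atom.node M' ⟨n, p, b⟩).1 := fun b i hi x hx =>
      List.mem_flatMap.2 ⟨_, List.mem_map.2 ⟨i, hi, rfl⟩, hx⟩
    rcases List.mem_append.1 hu with hu | hu
    · obtain ⟨i, hi, rfl⟩ := List.mem_map.1 hu
      exact .inl ⟨hmap _ _ (hin h i hi), hmap _ _ (hin a i hi)⟩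
    · obtain ⟨i, hi, rfl⟩ := List.mem_map.1 hu
      refine .inr ⟨hmap _ _ (hout a i hi), fun x hx => ?_⟩
      exact List.mem_append_left _ (List.mem_append_left _ (hout h i hi (hsub _ hx)))

theorem inputClause_tidyModInputs {M : ThreeModing L} {M' : Moding L} {P : Program L V}
    (hP : WeaklyTidy M M' P) {Q : Query L V} {h : List (SLDStep L V)} {C : Clause L V}
    (hC : InputClause P Q h C) : TidyModInputs M M' C := by
  obtain ⟨⟨D, hD, hCD⟩, -⟩ := hC
  obtain ⟨θ, hθ, hDθ⟩ := hP D hD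
  exact (tidyModInputs_of_tidyClause hθ hDθ).variant hCD

theorem unifiesTidily_selected {M : ThreeModing L} {M' : Moding L} {P : Program L V}
    (hP : WeaklyTidy M M' P) {Q : Query L V} {h : List (SLDStep L V)}
    (hQ : TidyQuery M' (lastQuery Q h)) (i : Fin (lastQuery Q h).length)
    (hi : InputGround M ((lastQuery Q h).get i)) {C : Clause L V} (hC : InputClause P Q h C)
    (hsym : ((lastQuery Q h).get i).symbol = C.head.symbol) :
    UnifiesTidily M' {.atom ((lastQuery Q h).get i) C.head}
      ((lastQuery Q h).take i ++ C.body ++ (lastQuery Q h).drop (i + 1)) := by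
  have hsplit : (lastQuery Q h).take i ++ (lastQuery Q h).get i ::
      (lastQuery Q h).drop (i + 1) = lastQuery Q h := by
    rw [List.get_eq_getElem, ← List.drop_eq_getElem_cons, List.take_append_drop]
  have hdisj := hC.2.2.1
  have hC' := inputClause_tidyModInputs hP hC
  refine unifiesTidily_atom ?_ hi hC' ?_ hsym
  · rwa [hsplit]
  · rwa [hsplit]

theorem Atom.symbol_subst (A : Atom L V) (f : V → L.Term V) : (A.subst f).symbol = A.symbol := rfl

theorem tidyQuery_lastQuery {M : ThreeModing L} {M' : Moding L} {P : Program L V}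
    (hP : WeaklyTidy M M' P) {Q : Query L V} (hQ : TidyQuery M' Q) {R : SelectionRule L V}
    (hR : Compatible M P Q R) {h : List (SLDStep L V)} (hh : Derivation P R Q h) :
    TidyQuery M' (lastQuery Q h) := by
  induction hh with
  | nil => exact hQ
  | cons h i C θ hd hi hC hθ ih =>
    have hsym : ((lastQuery Q h).get i).symbol = C.head.symbol := by
      rw [← Atom.symbol_subst _ θ.map, hθ.1, Atom.symbol_subst]
    refine (unifiesTidily_selected hP ih i ((hR h hd).1 i hi) hC hsym).2 θ ?_ fun τ hτ => ?_
    · rintro _ rfl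
      exact hθ.1
    · obtain ⟨η, hη⟩ := hθ.2 τ (hτ _ rfl)
      exact ⟨η, fun x _ => hη x⟩

end OccurCheck

theorem mainTheorem10 {L : FirstOrder.Language.{u, v}} {V : Type w} [Infinite V]
    (M : OccurCheck.ThreeModing L) (M' : OccurCheck.Moding L)
    (P : OccurCheck.Program L V) (hP : OccurCheck.WeaklyTidy M M' P)
    (Q : OccurCheck.Query L V) (hQ : OccurCheck.TidyQuery M' Q)
    (R : OccurCheck.SelectionRule L V) (hR : OccurCheck.Compatible M P Q R) :
    (∀ h, OccurCheck.Derivation P R Q h →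
      OccurCheck.TidyQuery M' (OccurCheck.lastQuery Q h)) ∧
    OccurCheck.WeaklyOccurCheckFree P R Q := by
  refine ⟨fun h hh => OccurCheck.tidyQuery_lastQuery hP hQ hR hh, ?_⟩
  rintro A H ⟨h, i, C, hd, hi, hC, rfl, rfl, hsym⟩
  have hT := OccurCheck.tidyQuery_lastQuery hP hQ hR hd
  -- A run starts with no solved equation. Unifiability of the pair is not needed here.
  have hU := (OccurCheck.unifiesTidily_selected hP hT i ((hR h hd).1 i hi) hC hsym).1 ∅
  rw [Set.empty_union] at hU
  exact hU fun e he => absurd he (Set.notMem_empty e)
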